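/- Let $A$ be a unital $C^*$-algebra. Its Cuntz semigroup $\mathrm{Cu}(A)$ is the set of classes $\langle a\rangle$ of positive elements $a$ of $A\otimes\mathcal K$ ($\mathcal K$ the compact operators on a separable infinite-dimensional Hilbert space), where $\langle a\rangle\le\langle b\rangle$ if $x_nbx_n^*\to a$ for some sequence $(x_n)$ in $A\otimes\mathcal K$, where $\langle a\rangle=\langle b\rangle$ if $\langle a\rangle\le\langle b\rangle\le\langle a\rangle$, and where addition is induced by orthogonal sums. Write $\langle 1_A\rangle$ for the class of $1_A\otimes e$ with $e$ a minimal projection in $\mathcal K$. For $u,v\in\mathrm{Cu}(A)$ write $u\ll v$ if, whenever $v=\sup_i v_i$ for an increasing sequence $(v_i)$ in $\mathrm{Cu}(A)$, then $u\le v_i$ for some $i$. For integers $m,n\ge 1$ an element $u\in\mathrm{Cu}(A)$ is called * $(m,n)$-divisible if for every $u'\ll u$ there is $x\in\mathrm{Cu}(A)$ with $mx\le u$ and $u'\le nx$; * $(m,n)$-decomposable if for every $u'\ll u$ there are $x_1,\dots,x_m\in\mathrm{Cu}(A)$ with $x_1+\cdots+x_m\le u$ and $u'\le nx_j$ for $j=1,\dots,m$;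 * weakly $(m,n)$-divisible if for every $u'\ll u$ there are $x_1,\dots,x_n\in\mathrm{Cu}(A)$ with $mx_j\le u$ for $j=1,\dots,n$ and $u'\le x_1+\cdots+x_n$. Let $\mathrm{Div}_m(A)$, $\partial\mathrm{iv}_m(A)$ and $\mathrm{div}_m(A)$ in $\{1,2,3,\dots,\infty\}$ be the least integer $n\ge 1$ such that $\langle 1_A\rangle$ is $(m,n)$-divisible, $(m,n)$-decomposable and weakly $(m,n)$-divisible, respectively ($\infty$ if there is no such $n$). For a sequence $(A_k)_{k\ge 1}$ of unital $C^*$-algebras let $\prod_{k=1}^\infty A_k$ be the $C^*$-algebra of all norm bounded sequences $(a_k)$ with $a_k\in A_k$. A (proper) filter $\omega$ on $\mathbb N$ is free if its members have empty intersection; for such $\omega$ let $\prod_\omega A_k$ be the quotient of $\prod_{k=1}^\infty A_k$ by the closed ideal of all $(a_k)$ with $\lim_\omega\|a_k\|=0$. For $d_k\in[0,\infty]$ put $\limsup_\omega d_k=\inf_{I\in\omega}\sup_{k\in I}d_k$. **Proposition.** Let $(A_k)$ be a sequence of unital $C^*$-algebras. Then for every integer $m\ge 2$ and every free filter $\omega$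 on $\mathbb N$: 1. $\mathrm{Div}_m\big(\prod_{k=1}^\infty A_k\big)=\sup_k\mathrm{Div}_m(A_k)$ and $\mathrm{Div}_m\big(\prod_\omega A_k\big)=\limsup_\omega\mathrm{Div}_m(A_k)$; 2. $\partial\mathrm{iv}_m\big(\prod_{k=1}^\infty A_k\big)=\sup_k\partial\mathrm{iv}_m(A_k)$ and $\partial\mathrm{iv}_m\big(\prod_\omega A_k\big)=\limsup_\omega\partial\mathrm{iv}_m(A_k)$; 3. $\mathrm{div}_m\big(\prod_{k=1}^\infty A_k\big)=\sup_k\mathrm{div}_m(A_k)$ and $\mathrm{div}_m\big(\prod_\omega A_k\big)=\limsup_\omega\mathrm{div}_m(A_k)$. -/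

import Mathlib

open Filter Topology
open scoped ENNReal

noncomputable section

namespace CuntzDiv

universe u

/-! ## Bounded products and reduced products of sequences of unital C⋆-algebras -/

section Products

variable (A : ℕ → Type u) [∀ k, CStarAlgebra (A k)]

/-- The C⋆-algebra `∏ₖ Aₖ` of all norm bounded sequences `(aₖ)` with `aₖ ∈ Aₖ`. -/
def BProd : Type u := lp A ∞

/-- The unit of a C⋆-algebra (possibly the zero algebra) has norm at most one. -/
theorem norm_one_le (B : Type u) [CStarAlgebra B] : ‖(1 : B)‖ ≤ 1 := by
  rcases subsingleton_or_nontrivial B with h | h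
  · rw [Subsingleton.elim (1 : B) 0, norm_zero]; exact zero_le_one
  · exact CStarRing.norm_one.le

instance instNonUnitalBProd : NonUnitalCStarAlgebra (BProd A) :=
  inferInstanceAs (NonUnitalCStarAlgebra (lp A ∞))

variable {A}

/-- The element of `∏ₖ Aₖ` given by a bounded sequence. -/
def BProd.mk (a : ∀ k, A k) (C : ℝ) (h : ∀ k, ‖a k‖ ≤ C) : BProd A :=
  ⟨a, memℓp_infty ⟨C, by rintro _ ⟨k, rfl⟩; exact h k⟩⟩

/-- The `k`-th coordinate of an element of `∏ₖ Aₖ`. -/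
def BProd.coord (a : BProd A) (k : ℕ) : A k := (show lp A ∞ from a).1 k

namespace BProd

theorem ext' {a b : BProd A} (h : ∀ k, a.coord k = b.coord k) : a = b :=
  lp.ext (funext h)

@[simp] theorem coord_mk (a : ∀ k, A k) (C : ℝ) (h : ∀ k, ‖a k‖ ≤ C) (k : ℕ) :
    (mk a C h).coord k = a k := rfl
@[simp] theorem coord_add (a b : BProd A) (k : ℕ) : (a + b).coord k = a.coord k + b.coord k := rfl
@[simp] theorem coord_sub (a b : BProd A) (k : ℕ) : (a - b).coord k = a.coord k - b.coord k := rfl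
@[simp] theorem coord_mul (a b : BProd A) (k : ℕ) : (a * b).coord k = a.coord k * b.coord k := rfl
@[simp] theorem coord_star (a : BProd A) (k : ℕ) : (star a).coord k = star (a.coord k) := rfl
@[simp] theorem coord_zero (k : ℕ) : (0 : BProd A).coord k = 0 := rfl
@[simp] theorem coord_smul (c : ℂ) (a : BProd A) (k : ℕ) :
    (c • a).coord k = c • a.coord k := rfl

theorem norm_coord_le (a : BProd A) (k : ℕ) : ‖a.coord k‖ ≤ ‖a‖ :=
  lp.norm_apply_le_norm ENNReal.top_ne_zero (show lp A ∞ from a) k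

theorem norm_le {a : BProd A} {C : ℝ} (hC : 0 ≤ C) (h : ∀ k, ‖a.coord k‖ ≤ C) : ‖a‖ ≤ C :=
  lp.norm_le_of_forall_le hC h

end BProd

instance instRingBProd : Ring (BProd A) :=
  { (inferInstance : NonUnitalRing (BProd A)) with
    one := BProd.mk (fun _ => 1) 1 (fun k => norm_one_le (A k))
    one_mul := fun a => BProd.ext' fun k => one_mul (a.coord k)
    mul_one := fun a => BProd.ext' fun k => mul_one (a.coord k) }

@[simp] theorem BProd.coord_one (k : ℕ) : (1 : BProd A).coord k = 1 := rfl

instance instNormedRingBProd : NormedRing (BProd A) :=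
  { instRingBProd, (inferInstance : NonUnitalNormedRing (BProd A)) with }

instance instAlgebraBProd : Algebra ℂ (BProd A) :=
  Algebra.ofModule (fun r x y => smul_mul_assoc r x y) (fun r x y => mul_smul_comm r x y)

instance instNormedAlgebraBProd : NormedAlgebra ℂ (BProd A) :=
  { instAlgebraBProd with norm_smul_le := fun r x => norm_smul_le r x }

instance instCStarAlgebraBProd : CStarAlgebra (BProd A) :=
  { instNormedRingBProd, instNormedAlgebraBProd, instNonUnitalBProd A with }

variable (A)

/-- The ideal `c_ω({Aₖ})` of all `(aₖ)` with `lim_ω ‖aₖ‖ = 0`. -/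
def cIdeal (ω : Filter ℕ) : Ideal (BProd A) where
  carrier := {a | Tendsto (fun k => ‖a.coord k‖) ω (𝓝 0)}
  add_mem' {a b} ha hb := by
    refine squeeze_zero (fun _ => norm_nonneg _) (fun k => norm_add_le (a.coord k) (b.coord k)) ?_
    simpa using Tendsto.add ha hb
  zero_mem' := by simpa using tendsto_const_nhds
  smul_mem' c a ha := by
    refine squeeze_zero (fun _ => norm_nonneg _) (fun k => ?_)
      (by simpa using Tendsto.const_mul ‖c‖ ha)
    exact (norm_mul_le (c.coord k) (a.coord k)).trans
      (mul_le_mul_of_nonneg_right (c.norm_coord_le k) (norm_nonneg _))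

variable {A}

theorem mem_cIdeal {ω : Filter ℕ} {a : BProd A} :
    a ∈ cIdeal A ω ↔ Tendsto (fun k => ‖a.coord k‖) ω (𝓝 0) := Iff.rfl

instance instTwoSided (ω : Filter ℕ) : (cIdeal A ω).IsTwoSided where
  mul_mem_of_left {a} b ha := by
    refine squeeze_zero (fun _ => norm_nonneg _) (fun k => ?_)
      (by simpa using Tendsto.mul_const ‖b‖ (mem_cIdeal.1 ha))
    exact (norm_mul_le (a.coord k) (b.coord k)).trans
      (mul_le_mul_of_nonneg_left (b.norm_coord_le k) (norm_nonneg _))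

instance instClosedIdeal (ω : Filter ℕ) : IsClosed (cIdeal A ω : Set (BProd A)) := by
  refine isClosed_of_closure_subset fun a ha => ?_
  change Tendsto (fun k => ‖a.coord k‖) ω (𝓝 0)
  rw [Metric.tendsto_nhds]
  intro ε hε
  obtain ⟨b, hb, hab⟩ := Metric.mem_closure_iff.1 ha (ε / 2) (half_pos hε)
  filter_upwards [(Metric.tendsto_nhds.1 (mem_cIdeal.1 hb)) (ε / 2) (half_pos hε)] with k hk
  rw [Real.dist_0_eq_abs, abs_norm] at hk ⊢
  have h1 : ‖a.coord k - b.coord k‖ ≤ ‖a - b‖ := (a - b).norm_coord_le k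
  rw [dist_eq_norm] at hab
  have h2 : ‖a.coord k‖ ≤ ‖a.coord k - b.coord k‖ + ‖b.coord k‖ := by
    simpa using norm_add_le (a.coord k - b.coord k) (b.coord k)
  linarith

theorem star_mem_cIdeal {ω : Filter ℕ} {a : BProd A} (ha : a ∈ cIdeal A ω) :
    star a ∈ cIdeal A ω := by
  rw [mem_cIdeal] at ha ⊢
  simpa using ha

variable (A)

/-- The C⋆-algebra `∏_ω Aₖ`, the quotient of `∏ₖ Aₖ` by the ideal `c_ω({Aₖ})`. -/
def RProd (ω : Filter ℕ) : Type u := BProd A ⧸ cIdeal A ω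

instance instRingRProd (ω : Filter ℕ) : Ring (RProd A ω) :=
  inferInstanceAs (Ring (BProd A ⧸ cIdeal A ω))

instance instAlgebraRProd (ω : Filter ℕ) : Algebra ℂ (RProd A ω) :=
  inferInstanceAs (Algebra ℂ (BProd A ⧸ cIdeal A ω))

/-- `RProd A ω` carries the quotient norm. -/
instance instNormedGroupRProd (ω : Filter ℕ) : NormedAddCommGroup (RProd A ω) :=
  inferInstanceAs (NormedAddCommGroup (BProd A ⧸ cIdeal A ω))

instance instCompleteRProd (ω : Filter ℕ) : CompleteSpace (RProd A ω) :=
  inferInstanceAs (CompleteSpace (BProd A ⧸ cIdeal A ω))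

variable {A}

/-- The quotient map `∏ₖ Aₖ → ∏_ω Aₖ`. -/
def RProd.mk (ω : Filter ℕ) : BProd A →ₐ[ℂ] RProd A ω := Ideal.Quotient.mkₐ ℂ (cIdeal A ω)

theorem RProd.mk_surjective (ω : Filter ℕ) : Function.Surjective (RProd.mk (A := A) ω) :=
  Ideal.Quotient.mk_surjective

theorem RProd.mk_eq_mk {ω : Filter ℕ} {a b : BProd A} :
    RProd.mk ω a = RProd.mk ω b ↔ a - b ∈ cIdeal A ω :=
  Ideal.Quotient.eq

theorem RProd.norm_mk_le (ω : Filter ℕ) (a : BProd A) : ‖RProd.mk ω a‖ ≤ ‖a‖ :=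
  Submodule.Quotient.norm_mk_le (cIdeal A ω) a

theorem RProd.exists_norm_lt {ω : Filter ℕ} (x : RProd A ω) {ε : ℝ} (hε : 0 < ε) :
    ∃ a, RProd.mk ω a = x ∧ ‖a‖ < ‖x‖ + ε :=
  Submodule.Quotient.norm_mk_lt (S := cIdeal A ω) x hε

theorem RProd.eventually_lt {ω : Filter ℕ} {a : BProd A} {r : ℝ} (h : ‖RProd.mk ω a‖ < r) :
    ∀ᶠ k in ω, ‖a.coord k‖ < r := by
  obtain ⟨b, hb, hbr⟩ := RProd.exists_norm_lt (RProd.mk ω a) (ε := r - ‖RProd.mk ω a‖) (by linarith)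
  have hbr' : ‖b‖ < r := by linarith
  have hab := mem_cIdeal.1 (RProd.mk_eq_mk.1 hb.symm)
  filter_upwards [(Metric.tendsto_nhds.1 hab) (r - ‖b‖) (by linarith)] with k hk
  rw [Real.dist_0_eq_abs, abs_norm, BProd.coord_sub] at hk
  have h2 : ‖a.coord k‖ ≤ ‖a.coord k - b.coord k‖ + ‖b.coord k‖ := by
    simpa using norm_add_le (a.coord k - b.coord k) (b.coord k)
  linarith [b.norm_coord_le k]

theorem RProd.norm_le {ω : Filter ℕ} {a : BProd A} {r : ℝ} (hr : 0 ≤ r)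
    (h : ∀ᶠ k in ω, ‖a.coord k‖ ≤ r) : ‖RProd.mk ω a‖ ≤ r := by
  classical
  let b : BProd A := BProd.mk (fun k => if ‖a.coord k‖ ≤ r then a.coord k else 0) r (fun k => by
    split_ifs with h
    · exact h
    · simpa using hr)
  have hb : RProd.mk ω a = RProd.mk ω b := by
    rw [RProd.mk_eq_mk, mem_cIdeal]
    refine (tendsto_congr' ?_).2 tendsto_const_nhds
    filter_upwards [h] with k hk
    simp [b, hk]
  rw [hb]
  refine (RProd.norm_mk_le ω b).trans (BProd.norm_le hr fun k => ?_)
  simp only [b, BProd.coord_mk]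
  split_ifs with h
  · exact h
  · simpa using hr

variable (A)

instance instNormedRingRProd (ω : Filter ℕ) : NormedRing (RProd A ω) :=
  { instRingRProd A ω, instNormedGroupRProd A ω with
    norm_mul_le := fun x y => by
      obtain ⟨a, rfl⟩ := RProd.mk_surjective ω x
      obtain ⟨b, rfl⟩ := RProd.mk_surjective ω y
      refine le_of_forall_pos_le_add fun ε hε => ?_
      have hc : Tendsto (fun δ : ℝ => (‖RProd.mk ω a‖ + δ) * (‖RProd.mk ω b‖ + δ)) (𝓝[>] 0)
          (𝓝 (‖RProd.mk ω a‖ * ‖RProd.mk ω b‖)) := by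
        have : Continuous fun δ : ℝ => (‖RProd.mk ω a‖ + δ) * (‖RProd.mk ω b‖ + δ) := by fun_prop
        simpa using (this.tendsto 0).mono_left nhdsWithin_le_nhds
      obtain ⟨δ, h1, h2⟩ := ((hc.eventually (gt_mem_nhds (lt_add_of_pos_right _ hε))).and
        self_mem_nhdsWithin).exists
      have hδ : 0 < δ := h2
      refine le_trans ?_ h1.le
      refine RProd.norm_le (a := a * b) (by positivity) ?_
      filter_upwards [RProd.eventually_lt (lt_add_of_pos_right ‖RProd.mk ω a‖ hδ),
        RProd.eventually_lt (lt_add_of_pos_right ‖RProd.mk ω b‖ hδ)] with k ha hb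
      exact (norm_mul_le _ _).trans (mul_le_mul ha.le hb.le (norm_nonneg _) (by positivity)) }

instance instStarRProd (ω : Filter ℕ) : Star (RProd A ω) where
  star := Quotient.lift (fun a : BProd A => RProd.mk ω (star a)) (fun a b hab => by
    have h : RProd.mk ω a = RProd.mk ω b := Quotient.sound hab
    rw [RProd.mk_eq_mk] at h ⊢
    rw [← star_sub]
    exact star_mem_cIdeal h)

theorem RProd.star_mk (ω : Filter ℕ) (a : BProd A) :
    star (RProd.mk ω a) = RProd.mk ω (star a) := rfl

instance instStarRingRProd (ω : Filter ℕ) : StarRing (RProd A ω) where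
  star_involutive x := by
    obtain ⟨a, rfl⟩ := RProd.mk_surjective ω x
    simp [RProd.star_mk]
  star_mul x y := by
    obtain ⟨a, rfl⟩ := RProd.mk_surjective ω x
    obtain ⟨b, rfl⟩ := RProd.mk_surjective ω y
    simp only [RProd.star_mk, ← map_mul, star_mul]
  star_add x y := by
    obtain ⟨a, rfl⟩ := RProd.mk_surjective ω x
    obtain ⟨b, rfl⟩ := RProd.mk_surjective ω y
    simp only [RProd.star_mk, ← map_add, star_add]

instance instNormedAlgebraRProd (ω : Filter ℕ) : NormedAlgebra ℂ (RProd A ω) :=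
  { instAlgebraRProd A ω with
    norm_smul_le := fun c x =>
      norm_smul_le (α := ℂ) (β := BProd A ⧸ cIdeal A ω) c x }

instance instCStarAlgebraRProd (ω : Filter ℕ) : CStarAlgebra (RProd A ω) where
  norm_mul_self_le x := by
    obtain ⟨a, rfl⟩ := RProd.mk_surjective ω x
    refine le_of_forall_gt_imp_ge_of_dense fun s hs => ?_
    have hs0 : 0 ≤ s := (norm_nonneg _).trans hs.le
    rw [RProd.star_mk, ← map_mul] at hs
    have h : ‖RProd.mk ω a‖ ≤ √s := by
      refine RProd.norm_le (Real.sqrt_nonneg s) ?_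
      filter_upwards [RProd.eventually_lt hs] with k hk
      rw [BProd.coord_mul, BProd.coord_star, CStarRing.norm_star_mul_self] at hk
      exact Real.le_sqrt_of_sq_le (by nlinarith)
    calc ‖RProd.mk ω a‖ * ‖RProd.mk ω a‖ ≤ √s * √s := by gcongr
      _ = s := Real.mul_self_sqrt hs0
  star_smul c x := by
    obtain ⟨a, rfl⟩ := RProd.mk_surjective ω x
    simp only [RProd.star_mk, ← map_smul, star_smul]

end Products

/-! ## The stabilization `A ⊗ 𝒦` -/

section Stabilization

attribute [local instance] CStarAlgebra.spectralOrder CStarAlgebra.spectralOrderedRing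

/-- The matrix algebra `Mₙ(A)` with its C⋆-norm. -/
def MatN (A : Type u) (n : ℕ) : Type u := CStarMatrix (Fin n) (Fin n) A

variable (A : Type u) [CStarAlgebra A]

instance instCStarAlgebraMatN (n : ℕ) : CStarAlgebra (MatN A n) :=
  inferInstanceAs (CStarAlgebra (CStarMatrix (Fin n) (Fin n) A))

variable {A}

/-- The matrix in `Mₙ(A)` with entry `a` at position `(i, j)` and zeros elsewhere (the zero matrix
if `(i, j)` does not fit). -/
def MatN.single (n i j : ℕ) (a : A) : MatN A n :=
  CStarMatrix.ofMatrix fun p q => if p.1 = i ∧ q.1 = j then a else 0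

/-- The entries of a matrix. -/
def MatN.entry {A : Type u} {n : ℕ} (x : MatN A n) (p q : Fin n) : A :=
  CStarMatrix.ofMatrix.symm x p q

theorem MatN.ext' {A : Type u} {n : ℕ} {x y : MatN A n}
    (h : ∀ p q, x.entry p q = y.entry p q) : x = y :=
  CStarMatrix.ext h

theorem MatN.single_add (n i j : ℕ) (a b : A) :
    single n i j (a + b) = single n i j a + single n i j b := by
  refine MatN.ext' fun p q => ?_
  change (if p.1 = i ∧ q.1 = j then a + b else 0) =
    (if p.1 = i ∧ q.1 = j then a else 0) + (if p.1 = i ∧ q.1 = j then b else 0)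
  split_ifs <;> simp

theorem MatN.single_smul (n i j : ℕ) (c : ℂ) (a : A) :
    single n i j (c • a) = c • single n i j a := by
  refine MatN.ext' fun p q => ?_
  change (if p.1 = i ∧ q.1 = j then c • a else 0) = c • (if p.1 = i ∧ q.1 = j then a else 0)
  split_ifs <;> simp

theorem MatN.single_star (n i j : ℕ) (a : A) :
    star (single n i j a) = single n j i (star a) := by
  refine MatN.ext' fun p q => ?_
  change star (if q.1 = i ∧ p.1 = j then a else 0) = (if p.1 = j ∧ q.1 = i then star a else 0)
  by_cases h1 : q.1 = i <;> by_cases h2 : p.1 = j <;> simp [h1, h2]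

theorem MatN.single_mul (n i j k l : ℕ) (a b : A) :
    single n i j a * single n k l b = if j = k ∧ j < n then single n i l (a * b) else 0 := by
  have hsum : ∀ p q : Fin n, (single n i j a * single n k l b).entry p q =
      ∑ r : Fin n, (if p.1 = i ∧ r.1 = j then a else 0) * (if r.1 = k ∧ q.1 = l then b else 0) :=
    fun _ _ => rfl
  split_ifs with h
  · obtain ⟨rfl, hj⟩ := h
    refine MatN.ext' fun p q => ?_
    rw [hsum, Finset.sum_eq_single ⟨j, hj⟩]
    · change _ = if p.1 = i ∧ q.1 = l then a * b else 0
      by_cases h1 : p.1 = i <;> by_cases h2 : q.1 = l <;> simp [h1, h2]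
    · intro r _ hr
      have : r.1 ≠ j := fun h => hr (Fin.ext h)
      simp [this]
    · simp
  · refine MatN.ext' fun p q => ?_
    rw [hsum]
    change _ = (0 : A)
    refine Finset.sum_eq_zero fun r _ => ?_
    by_cases h1 : r.1 = j
    · have : r.1 ≠ k := fun h2 => h ⟨h1.symm.trans h2, h1 ▸ r.2⟩
      simp [this]
    · simp [h1]

theorem MatN.norm_single_le (n i j : ℕ) (a : A) : ‖single n i j a‖ ≤ ‖a‖ := by
  classical
  have hdiag : ∀ b : A, ‖single n j j b‖ ≤ ‖b‖ := by
    intro b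
    by_cases hj : j < n
    · let φ : A →⋆ₙₐ[ℂ] MatN A n :=
        { toFun := single n j j
          map_smul' := fun c x => single_smul n j j c x
          map_zero' := by
            have := single_smul n j j (0 : ℂ) (0 : A)
            simpa using this
          map_add' := fun x y => single_add n j j x y
          map_mul' := fun x y => by rw [single_mul, if_pos ⟨rfl, hj⟩]
          map_star' := fun x => (single_star n j j x).symm }
      exact NonUnitalStarAlgHom.norm_apply_le φ b
    · have : single n j j b = 0 := by
        refine MatN.ext' fun p q => ?_
        change (if p.1 = j ∧ q.1 = j then b else 0) = 0
        have : p.1 ≠ j := fun h => hj (h ▸ p.2)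
        simp [this]
      rw [this, norm_zero]
      exact norm_nonneg _
  have h1 : ‖single n i j a‖ * ‖single n i j a‖ ≤ ‖a‖ * ‖a‖ := by
    rw [← CStarRing.norm_star_mul_self, single_star, single_mul, ← CStarRing.norm_star_mul_self]
    split_ifs
    · exact hdiag _
    · rw [norm_zero]; exact norm_nonneg _
  exact abs_le_of_sq_le_sq' (by nlinarith) (norm_nonneg _) |>.2

variable (A)

/-- The C⋆-algebra `∏ₙ Mₙ(A) / ⊕ₙ Mₙ(A)`, in which the inductive limit of the matrix algebras
`Mₙ(A)` is realized. -/
abbrev MatSeq : Type u := RProd (MatN A) atTop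

variable {A}

/-- The element `a ⊗ eᵢⱼ` of the inductive limit of the matrix algebras `Mₙ(A)`, represented by the
sequence whose `n`-th term is the `n × n` matrix with entry `a` at position `(i, j)`. -/
def tensorUnit (i j : ℕ) (a : A) : MatSeq A :=
  RProd.mk atTop (BProd.mk (fun n => MatN.single n i j a) ‖a‖ (fun n => MatN.norm_single_le n i j a))

variable (A)

/-- The stabilization `A ⊗ 𝒦`: the C⋆-algebraic inductive limit of the matrix algebras `Mₙ(A)` along
the upper left corner embeddings `Mₙ(A) → Mₙ₊₁(A)`.  It is realized as the closed ⋆-subalgebra of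
`∏ₙ Mₙ(A) / ⊕ₙ Mₙ(A)` generated by the elements `a ⊗ eᵢⱼ`. -/
def stabSubalgebra : NonUnitalStarSubalgebra ℂ (MatSeq A) :=
  (NonUnitalStarAlgebra.adjoin ℂ
    {x : MatSeq A | ∃ (i j : ℕ) (a : A), x = tensorUnit i j a}).topologicalClosure

instance instClosedStab : IsClosed (stabSubalgebra A : Set (MatSeq A)) :=
  NonUnitalStarSubalgebra.isClosed_topologicalClosure _

/-- The stabilization `A ⊗ 𝒦` as a C⋆-algebra. -/
def Stab : Type u := stabSubalgebra A

instance instCStarAlgebraStab : NonUnitalCStarAlgebra (Stab A) :=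
  inferInstanceAs (NonUnitalCStarAlgebra (stabSubalgebra A))

variable {A}

/-- The element `a ⊗ eᵢⱼ` of `A ⊗ 𝒦`. -/
def Stab.single (i j : ℕ) (a : A) : Stab A :=
  ⟨tensorUnit i j a, NonUnitalStarSubalgebra.le_topologicalClosure _
    (NonUnitalStarAlgebra.subset_adjoin ℂ _ ⟨i, j, a, rfl⟩)⟩

namespace Stab

theorem ext_mk {x y : Stab A} (h : x.1 = y.1) : x = y := Subtype.ext h

theorem single_add (i j : ℕ) (a b : A) : single i j (a + b) = single i j a + single i j b := by
  refine ext_mk ?_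
  change RProd.mk atTop _ = RProd.mk atTop _ + RProd.mk atTop _
  rw [← map_add]
  exact congrArg _ (BProd.ext' fun n => MatN.single_add n i j a b)

theorem single_smul (i j : ℕ) (c : ℂ) (a : A) : single i j (c • a) = c • single i j a := by
  refine ext_mk ?_
  change RProd.mk atTop _ = c • RProd.mk atTop _
  rw [← map_smul]
  exact congrArg _ (BProd.ext' fun n => MatN.single_smul n i j c a)

theorem single_zero (i j : ℕ) : single i j (0 : A) = 0 := by
  simpa using single_smul i j (0 : ℂ) (0 : A)

theorem star_single (i j : ℕ) (a : A) : star (single i j a) = single j i (star a) := by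
  refine ext_mk ?_
  change star (RProd.mk atTop _) = RProd.mk atTop _
  rw [RProd.star_mk]
  exact congrArg _ (BProd.ext' fun n => MatN.single_star n i j a)

theorem single_mul_single (i j k l : ℕ) (a b : A) :
    single i j a * single k l b = if j = k then single i l (a * b) else 0 := by
  refine ext_mk ?_
  change RProd.mk atTop _ * RProd.mk atTop _ = _
  rw [← map_mul]
  split_ifs with h
  · change _ = RProd.mk atTop _
    rw [RProd.mk_eq_mk, mem_cIdeal]
    refine (tendsto_congr' ?_).2 tendsto_const_nhds
    filter_upwards [eventually_gt_atTop j] with n hn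
    simp [MatN.single_mul, h, h ▸ hn]
  · change _ = (0 : MatSeq A)
    rw [← map_zero (RProd.mk (A := MatN A) atTop)]
    refine congrArg _ (BProd.ext' fun n => ?_)
    simp [MatN.single_mul, h]

theorem norm_single_le (i j : ℕ) (a : A) : ‖single i j a‖ ≤ ‖a‖ :=
  (RProd.norm_mk_le atTop _).trans
    (BProd.norm_le (norm_nonneg _) fun n => MatN.norm_single_le n i j a)

end Stab

namespace Stab

/-- The partial isometry `∑_{i < n} 1 ⊗ e_{f(i),i}` for an injective map `f`; for `f = id` it is the
projection `1 ⊗ (e₀₀ + ⋯ + eₙ₋₁,ₙ₋₁)`. -/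
def shift (A : Type u) [CStarAlgebra A] (f : ℕ → ℕ) (n : ℕ) : Stab A :=
  ∑ i ∈ Finset.range n, single (f i) i 1

theorem star_shift (f : ℕ → ℕ) (n : ℕ) :
    star (shift A f n) = ∑ i ∈ Finset.range n, single i (f i) 1 := by
  simp [shift, star_sum, star_single]

theorem star_shift_mul_shift {f : ℕ → ℕ} (hf : f.Injective) {m n : ℕ} (h : n ≤ m) :
    star (shift A f m) * shift A f n = shift A id n := by
  rw [star_shift, shift, Finset.sum_mul_sum, Finset.sum_comm, shift]
  refine Finset.sum_congr rfl fun j hj => ?_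
  rw [Finset.sum_eq_single j]
  · simp [single_mul_single]
  · intro i _ hij
    rw [single_mul_single, if_neg fun h => hij (hf h)]
  · intro h'
    exact absurd (Finset.mem_range.2 ((Finset.mem_range.1 hj).trans_le h)) h'

theorem star_shift_mul_shift_of_disjoint {f g : ℕ → ℕ} (h : ∀ i j, f i ≠ g j) (m n : ℕ) :
    star (shift A f m) * shift A g n = 0 := by
  rw [star_shift, shift, Finset.sum_mul_sum]
  refine Finset.sum_eq_zero fun i _ => Finset.sum_eq_zero fun j _ => ?_
  rw [single_mul_single, if_neg (h i j)]

theorem shift_mul_proj (f : ℕ → ℕ) {m n : ℕ} (h : n ≤ m) :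
    shift A f m * shift A id n = shift A f n := by
  rw [shift, shift, Finset.sum_mul_sum, Finset.sum_comm, shift]
  refine Finset.sum_congr rfl fun j hj => ?_
  rw [Finset.sum_eq_single j]
  · simp [single_mul_single]
  · intro i _ hij
    simp [single_mul_single, hij]
  · intro h'
    exact absurd (Finset.mem_range.2 ((Finset.mem_range.1 hj).trans_le h)) h'

theorem star_proj (n : ℕ) : star (shift A id n) = shift A id n := by
  rw [star_shift]; rfl

theorem proj_mul_star_shift (f : ℕ → ℕ) {m n : ℕ} (h : n ≤ m) :
    shift A id n * star (shift A f m) = star (shift A f n) := by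
  rw [← shift_mul_proj f h, star_mul, star_proj]

theorem norm_proj_le (n : ℕ) : ‖shift A id n‖ ≤ 1 := by
  have h := CStarRing.norm_star_mul_self (x := shift A id n)
  rw [star_shift_mul_shift Function.injective_id le_rfl] at h
  by_contra! hc
  nlinarith

theorem norm_shift_le {f : ℕ → ℕ} (hf : f.Injective) (n : ℕ) : ‖shift A f n‖ ≤ 1 := by
  have h := CStarRing.norm_star_mul_self (x := shift A f n)
  rw [star_shift_mul_shift hf le_rfl] at h
  have := norm_proj_le (A := A) n
  by_contra! hc
  nlinarith

theorem norm_conj_le {u x : Stab A} (hu : ‖u‖ ≤ 1) : ‖u * x * star u‖ ≤ ‖x‖ := by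
  have h1 : ‖u * x * star u‖ ≤ ‖u‖ * ‖x‖ * ‖u‖ := by
    simpa using (norm_mul_le (u * x) (star u)).trans
      (mul_le_mul_of_nonneg_right (norm_mul_le u x) (norm_nonneg _))
  have h2 : ‖u‖ * ‖x‖ ≤ ‖x‖ := by nlinarith [norm_nonneg x]
  nlinarith [norm_nonneg u, norm_nonneg x, mul_nonneg (norm_nonneg u) (norm_nonneg x)]

/-- Elements supported in a finite matrix block are dense in `A ⊗ 𝒦`. -/
theorem exists_approx (x : Stab A) {ε : ℝ} (hε : 0 < ε) :
    ∃ y : Stab A, ‖x - y‖ < ε ∧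
      ∀ᶠ n in atTop, shift A id n * y = y ∧ y * shift A id n = y := by
  have key : ∀ y ∈ NonUnitalStarAlgebra.adjoin ℂ
      {x : MatSeq A | ∃ (i j : ℕ) (a : A), x = tensorUnit i j a},
      ∀ᶠ n in atTop, (shift A id n).1 * y = y ∧ y * (shift A id n).1 = y := by
    intro y hy
    induction hy using NonUnitalStarAlgebra.adjoin_induction with
    | mem y hy =>
      obtain ⟨i, j, a, rfl⟩ := hy
      filter_upwards [eventually_gt_atTop i, eventually_gt_atTop j] with n hi hj
      have h1 : shift A id n * single i j a = single i j a := by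
        rw [shift, Finset.sum_mul, Finset.sum_eq_single i]
        · simp [single_mul_single]
        · intro k _ hk
          rw [single_mul_single, if_neg hk]
        · intro h; exact absurd (Finset.mem_range.2 hi) h
      have h2 : single i j a * shift A id n = single i j a := by
        rw [shift, Finset.mul_sum, Finset.sum_eq_single j]
        · simp [single_mul_single]
        · intro k _ hk
          rw [single_mul_single, if_neg fun h => hk h.symm]
        · intro h; exact absurd (Finset.mem_range.2 hj) h
      exact ⟨congrArg Subtype.val h1, congrArg Subtype.val h2⟩
    | add y z _ _ hy hz =>
      filter_upwards [hy, hz] with n h1 h2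
      rw [mul_add, add_mul, h1.1, h1.2, h2.1, h2.2]
      exact ⟨rfl, rfl⟩
    | zero => simp
    | mul y z _ _ hy hz =>
      filter_upwards [hy, hz] with n h1 h2
      rw [← mul_assoc, h1.1, mul_assoc, h2.2]
      exact ⟨rfl, rfl⟩
    | smul r y _ hy =>
      filter_upwards [hy] with n h1
      rw [mul_smul_comm, smul_mul_assoc, h1.1, h1.2]
      exact ⟨rfl, rfl⟩
    | star y _ hy =>
      filter_upwards [hy] with n h1
      have h3 : star (shift A id n).1 = (shift A id n).1 := congrArg Subtype.val (star_proj n)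
      constructor
      · conv_lhs => rw [← h3, ← star_mul, h1.2]
      · conv_lhs => rw [← h3, ← star_mul, h1.1]
  obtain ⟨y, hy, hxy⟩ := Metric.mem_closure_iff.1 x.2 ε hε
  refine ⟨⟨y, NonUnitalStarSubalgebra.le_topologicalClosure _ hy⟩, ?_, ?_⟩
  · rw [dist_eq_norm] at hxy
    exact hxy
  · filter_upwards [key y hy] with n hn
    exact ⟨Subtype.ext hn.1, Subtype.ext hn.2⟩

theorem tendsto_proj_mul (x : Stab A) :
    Tendsto (fun n => shift A id n * x) atTop (𝓝 x) := by
  rw [Metric.tendsto_nhds]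
  intro ε hε
  obtain ⟨y, hxy, hy⟩ := exists_approx x (half_pos hε)
  filter_upwards [hy] with n hn
  have h1 : shift A id n * x - x = shift A id n * (x - y) - (x - y) := by
    rw [mul_sub, hn.1]; abel
  rw [dist_eq_norm, h1]
  have h2 := norm_sub_le (shift A id n * (x - y)) (x - y)
  have h3 := norm_mul_le (shift A id n) (x - y)
  have h4 := norm_proj_le (A := A) n
  nlinarith [norm_nonneg (x - y)]

theorem tendsto_mul_proj (x : Stab A) :
    Tendsto (fun n => x * shift A id n) atTop (𝓝 x) := by
  have := (tendsto_proj_mul (star x)).star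
  simpa [star_proj] using this

theorem cauchySeq_conj {f : ℕ → ℕ} (hf : f.Injective) (x : Stab A) :
    CauchySeq fun n => shift A f n * x * star (shift A f n) := by
  rw [Metric.cauchySeq_iff']
  intro ε hε
  obtain ⟨y, hxy, hy⟩ := exists_approx x (half_pos hε)
  obtain ⟨N, hN⟩ := hy.exists
  refine ⟨N, fun n hn => ?_⟩
  have hconst : shift A f n * y * star (shift A f n) = shift A f N * y * star (shift A f N) := by
    have hy' : y = shift A id N * y * shift A id N := by rw [hN.1, hN.2]
    conv_lhs => rw [hy']
    rw [← shift_mul_proj f hn, star_mul, star_proj]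
    simp only [mul_assoc]
  have h1 : shift A f n * x * star (shift A f n) - shift A f N * x * star (shift A f N)
      = shift A f n * (x - y) * star (shift A f n)
        - shift A f N * (x - y) * star (shift A f N) := by
    simp only [mul_sub, sub_mul]
    rw [hconst]
    abel
  rw [dist_eq_norm, h1]
  have h2 := norm_sub_le (shift A f n * (x - y) * star (shift A f n))
    (shift A f N * (x - y) * star (shift A f N))
  have h3 := norm_conj_le (x := x - y) (norm_shift_le (A := A) hf n)
  have h4 := norm_conj_le (x := x - y) (norm_shift_le (A := A) hf N)
  linarith

/-- For an injective map `f : ℕ → ℕ`, the endomorphism of `A ⊗ 𝒦` that moves the matrix entry in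
position `(i, j)` to position `(f i, f j)`, i.e. `x ↦ V x V⋆` with the isometry
`V = ∑ᵢ 1 ⊗ e_{f(i),i}` of the multiplier algebra. -/
def relabel (f : ℕ → ℕ) (x : Stab A) : Stab A :=
  limUnder atTop fun n => shift A f n * x * star (shift A f n)

section relabel

variable {f g : ℕ → ℕ}

theorem tendsto_relabel (hf : f.Injective) (x : Stab A) :
    Tendsto (fun n => shift A f n * x * star (shift A f n)) atTop (𝓝 (relabel f x)) :=
  (cauchySeq_conj hf x).tendsto_limUnder

theorem relabel_single (hf : f.Injective) (i j : ℕ) (a : A) :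
    relabel f (single i j a) = single (f i) (f j) a := by
  refine tendsto_nhds_unique (tendsto_relabel hf _) ((tendsto_congr' ?_).2 tendsto_const_nhds)
  filter_upwards [eventually_gt_atTop i, eventually_gt_atTop j] with n hi hj
  rw [star_shift, shift, Finset.sum_mul, Finset.sum_mul, Finset.sum_eq_single i]
  · rw [Finset.mul_sum, Finset.sum_eq_single j]
    · simp [single_mul_single]
    · intro k _ hk
      simp [single_mul_single, hk.symm]
    · intro h; exact absurd (Finset.mem_range.2 hj) h
  · intro k _ hk
    rw [single_mul_single, if_neg hk, zero_mul]
  · intro h; exact absurd (Finset.mem_range.2 hi) h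

theorem relabel_sub (hf : f.Injective) (x y : Stab A) :
    relabel f (x - y) = relabel f x - relabel f y := by
  refine tendsto_nhds_unique (tendsto_relabel hf _) ?_
  simpa [mul_sub, sub_mul] using (tendsto_relabel hf x).sub (tendsto_relabel hf y)

theorem relabel_add (hf : f.Injective) (x y : Stab A) :
    relabel f (x + y) = relabel f x + relabel f y := by
  refine tendsto_nhds_unique (tendsto_relabel hf _) ?_
  simpa [mul_add, add_mul] using (tendsto_relabel hf x).add (tendsto_relabel hf y)

theorem relabel_star (hf : f.Injective) (x : Stab A) :
    relabel f (star x) = star (relabel f x) := by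
  refine tendsto_nhds_unique (tendsto_relabel hf _) ?_
  simpa [mul_assoc] using (tendsto_relabel hf x).star

theorem relabel_zero (hf : f.Injective) : relabel f (0 : Stab A) = 0 := by
  simpa using relabel_sub hf (0 : Stab A) 0

theorem norm_relabel_le (hf : f.Injective) (x : Stab A) : ‖relabel f x‖ ≤ ‖x‖ :=
  le_of_tendsto' (tendsto_relabel hf x).norm fun n => norm_conj_le (norm_shift_le hf n)

theorem relabel_id (x : Stab A) : relabel id x = x := by
  refine tendsto_nhds_unique (tendsto_relabel Function.injective_id x) ?_
  rw [Metric.tendsto_nhds]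
  intro ε hε
  obtain ⟨y, hxy, hy⟩ := exists_approx x (half_pos hε)
  filter_upwards [hy] with n hn
  have h1 : shift A id n * x * star (shift A id n) - x =
      shift A id n * (x - y) * star (shift A id n) - (x - y) := by
    have : shift A id n * y * star (shift A id n) = y := by rw [star_proj, hn.1, hn.2]
    rw [mul_sub, sub_mul, this]; abel
  rw [dist_eq_norm, h1]
  have h2 := norm_sub_le (shift A id n * (x - y) * star (shift A id n)) (x - y)
  have h3 := norm_conj_le (x := x - y) (norm_proj_le (A := A) n)
  linarith

theorem relabel_mul (hf : f.Injective) (x y : Stab A) :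
    relabel f (x * y) = relabel f x * relabel f y := by
  have h1 := (tendsto_relabel hf x).mul (tendsto_relabel hf y)
  have h2 : Tendsto (fun n => shift A f n * (x * (y - shift A id n * y)) * star (shift A f n))
      atTop (𝓝 0) := by
    refine squeeze_zero_norm (fun n => norm_conj_le (norm_shift_le hf n)) ?_
    have h3 : Tendsto (fun n => x * (y - shift A id n * y)) atTop (𝓝 (x * (y - y))) :=
      (tendsto_const_nhds.sub (tendsto_proj_mul y)).const_mul x
    simpa using h3.norm
  have h4 := h1.add h2
  rw [add_zero] at h4
  refine tendsto_nhds_unique (tendsto_relabel hf _) (h4.congr fun n => ?_)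
  have h5 : shift A f n * x * star (shift A f n) * (shift A f n * y * star (shift A f n)) =
      shift A f n * x * (star (shift A f n) * shift A f n) * y * star (shift A f n) := by
    simp only [mul_assoc]
  rw [h5, star_shift_mul_shift hf le_rfl]
  simp only [mul_sub, sub_mul, mul_assoc]
  abel

theorem star_shift_mul_relabel (hf : f.Injective) (n : ℕ) (x : Stab A) :
    star (shift A f n) * relabel f x * shift A f n = shift A id n * x * shift A id n := by
  refine tendsto_nhds_unique
    (((tendsto_relabel hf x).const_mul (star (shift A f n))).mul_const (shift A f n))
    ((tendsto_congr' ?_).2 tendsto_const_nhds)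
  filter_upwards [eventually_ge_atTop n] with m hm
  have h1 : star (shift A f n) * shift A f m = shift A id n := by
    have := congrArg star (star_shift_mul_shift (A := A) hf hm)
    simpa [star_proj] using this
  calc star (shift A f n) * (shift A f m * x * star (shift A f m)) * shift A f n
      = (star (shift A f n) * shift A f m) * x * (star (shift A f m) * shift A f n) := by
        simp only [mul_assoc]
    _ = _ := by rw [h1, star_shift_mul_shift hf hm]

theorem star_shift_mul_relabel_of_disjoint (hf : f.Injective) (h : ∀ i j, g i ≠ f j) (n : ℕ)
    (x : Stab A) : star (shift A g n) * relabel f x = 0 := by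
  refine tendsto_nhds_unique ((tendsto_relabel hf x).const_mul (star (shift A g n)))
    (tendsto_const_nhds.congr fun m => ?_)
  rw [← mul_assoc, ← mul_assoc, star_shift_mul_shift_of_disjoint h, zero_mul, zero_mul]

theorem relabel_mul_of_disjoint (hf : f.Injective) (hg : g.Injective) (h : ∀ i j, f i ≠ g j)
    (x y : Stab A) : relabel f x * relabel g y = 0 := by
  refine tendsto_nhds_unique ((tendsto_relabel hf x).mul_const (relabel g y))
    (tendsto_const_nhds.congr fun m => ?_)
  rw [mul_assoc, star_shift_mul_relabel_of_disjoint hg h, mul_zero]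

theorem relabel_comp (hf : f.Injective) (hg : g.Injective) (x : Stab A) :
    relabel f (relabel g x) = relabel (f ∘ g) x := by
  have hshift : ∀ n, ∃ M, ∀ m, M ≤ m → shift A f m * shift A g n = shift A (f ∘ g) n := by
    intro n
    refine ⟨(Finset.range n).sup g + 1, fun m hm => ?_⟩
    rw [shift, shift, Finset.sum_mul_sum, Finset.sum_comm, shift]
    refine Finset.sum_congr rfl fun j hj => ?_
    rw [Finset.sum_eq_single (g j)]
    · simp [single_mul_single]
    · intro i _ hij
      rw [single_mul_single, if_neg hij]
    · intro h'
      have := Finset.le_sup (f := g) hj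
      exact absurd (Finset.mem_range.2 (by omega)) h'
  have hn : ∀ n, relabel f (shift A g n * x * star (shift A g n)) =
      shift A (f ∘ g) n * x * star (shift A (f ∘ g) n) := by
    intro n
    obtain ⟨M, hM⟩ := hshift n
    refine tendsto_nhds_unique (tendsto_relabel hf _) ((tendsto_congr' ?_).2 tendsto_const_nhds)
    filter_upwards [eventually_ge_atTop M] with m hm
    rw [← hM m hm, star_mul]
    simp only [mul_assoc]
  have hlim : Tendsto (fun n => relabel f (shift A g n * x * star (shift A g n))) atTop
      (𝓝 (relabel f (relabel g x))) := by
    rw [tendsto_iff_norm_sub_tendsto_zero]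
    refine squeeze_zero (fun _ => norm_nonneg _) (fun n => ?_)
      (tendsto_iff_norm_sub_tendsto_zero.1 (tendsto_relabel hg x))
    rw [← relabel_sub hf]
    exact norm_relabel_le hf _
  exact tendsto_nhds_unique hlim
    ((tendsto_relabel (hf.comp hg) x).congr fun n => (hn n).symm)

end relabel

end Stab

end Stabilization

/-! ## The Cuntz semigroup -/

section Cuntz

variable {A : Type u} [CStarAlgebra A]

/-- Cuntz subequivalence `a ≾ b` in `A ⊗ 𝒦`: there are `xₙ` with `xₙ b xₙ⋆ → a`. -/
def CuntzLE (a b : Stab A) : Prop :=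
  ∀ ε : ℝ, 0 < ε → ∃ x : Stab A, ‖x * b * star x - a‖ < ε

theorem CuntzLE.refl (a : Stab A) : CuntzLE a a := by
  intro ε hε
  have h := Stab.tendsto_relabel Function.injective_id a
  rw [Stab.relabel_id, Metric.tendsto_nhds] at h
  obtain ⟨n, hn⟩ := (h ε hε).exists
  rw [dist_eq_norm] at hn
  exact ⟨_, hn⟩

theorem CuntzLE.trans {a b c : Stab A} (hab : CuntzLE a b) (hbc : CuntzLE b c) : CuntzLE a c := by
  intro ε hε
  obtain ⟨x, hx⟩ := hab (ε / 2) (half_pos hε)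
  have hpos : 0 < ‖x‖ * ‖x‖ + 1 := by positivity
  obtain ⟨y, hy⟩ := hbc (ε / 2 / (‖x‖ * ‖x‖ + 1)) (by positivity)
  refine ⟨x * y, ?_⟩
  have h1 : x * y * c * star (x * y) - a =
      x * (y * c * star y - b) * star x + (x * b * star x - a) := by
    simp only [star_mul, mul_sub, sub_mul, mul_assoc]
    abel
  rw [h1]
  have h2 : ‖x * (y * c * star y - b) * star x‖ ≤ ‖x‖ * ‖y * c * star y - b‖ * ‖x‖ := by
    simpa using (norm_mul_le (x * (y * c * star y - b)) (star x)).trans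
      (mul_le_mul_of_nonneg_right (norm_mul_le _ _) (norm_nonneg _))
  rw [lt_div_iff₀ hpos] at hy
  have h3 := norm_add_le (x * (y * c * star y - b) * star x) (x * b * star x - a)
  nlinarith [norm_nonneg (y * c * star y - b)]

theorem CuntzLE.of_tendsto {a b : Stab A} (x : ℕ → Stab A)
    (h : Tendsto (fun n => x n * b * star (x n)) atTop (𝓝 a)) : CuntzLE a b := by
  intro ε hε
  obtain ⟨n, hn⟩ := (Metric.tendsto_nhds.1 h ε hε).exists
  rw [dist_eq_norm] at hn
  exact ⟨_, hn⟩

/-- Orthogonal sums of relabelled copies do not depend on the relabellings, up to Cuntz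
equivalence. -/
theorem CuntzLE.sum_relabel {J : Type} [Fintype J] (f g : J → ℕ → ℕ)
    (hf : ∀ j, (f j).Injective) (hg : ∀ j, (g j).Injective)
    (hg' : ∀ j k, j ≠ k → ∀ m n, g j m ≠ g k n) (a : J → Stab A) :
    CuntzLE (∑ j, Stab.relabel (f j) (a j)) (∑ j, Stab.relabel (g j) (a j)) := by
  have hX : ∀ n j, star (Stab.shift A (g j) n) * (∑ k, Stab.relabel (g k) (a k)) =
      star (Stab.shift A (g j) n) * Stab.relabel (g j) (a j) := by
    intro n j
    rw [Finset.mul_sum, Finset.sum_eq_single j]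
    · intro k _ hk
      exact Stab.star_shift_mul_relabel_of_disjoint (hg k) (fun m n => hg' j k hk.symm m n) n _
    · simp
  have hY : ∀ n j k, j ≠ k → Stab.relabel (g j) (a j) * Stab.shift A (g k) n = 0 := by
    intro n j k hjk
    have h := Stab.star_shift_mul_relabel_of_disjoint (hg j)
      (fun m n => hg' k j hjk.symm m n) n (star (a j))
    rw [Stab.relabel_star (hg j), ← star_mul] at h
    exact star_eq_zero.1 h
  refine CuntzLE.of_tendsto
    (fun n => ∑ j, Stab.shift A (f j) n * star (Stab.shift A (g j) n)) ?_
  refine (tendsto_finsetSum _ fun j _ => Stab.tendsto_relabel (hf j) (a j)).congr fun n => ?_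
  rw [Finset.sum_mul, star_sum, Finset.sum_mul]
  refine Finset.sum_congr rfl fun j _ => ?_
  rw [Finset.mul_sum, Finset.sum_eq_single j]
  · calc Stab.shift A (f j) n * a j * star (Stab.shift A (f j) n)
        = (Stab.shift A (f j) n * Stab.shift A id n) * a j *
            star (Stab.shift A (f j) n * Stab.shift A id n) := by
          rw [Stab.shift_mul_proj _ le_rfl]
      _ = Stab.shift A (f j) n * (star (Stab.shift A (g j) n) * Stab.relabel (g j) (a j) *
            Stab.shift A (g j) n) * star (Stab.shift A (f j) n) := by
          rw [Stab.star_shift_mul_relabel (hg j), star_mul, Stab.star_proj]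
          simp only [mul_assoc]
      _ = _ := by
          rw [mul_assoc (Stab.shift A (f j) n) _ (∑ k, Stab.relabel (g k) (a k)), hX, star_mul,
            star_star]
          simp only [mul_assoc]
  · intro k _ hk
    rw [mul_assoc (Stab.shift A (f j) n) _ (∑ k, Stab.relabel (g k) (a k)), hX, star_mul,
      star_star]
    have := hY n j k hk.symm
    rw [mul_assoc, mul_assoc, ← mul_assoc (Stab.relabel (g j) (a j)), this]
    simp
  · simp

variable (A) in
/-- The set of positive elements of `A ⊗ 𝒦`. -/
structure PosElt : Type u where
  /-- The underlying element of `A ⊗ 𝒦`. -/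
  val : Stab A
  pos : ∃ b, val = star b * b

instance instPreorderPosElt : Preorder (PosElt A) where
  le a b := CuntzLE a.1 b.1
  le_refl a := CuntzLE.refl a.1
  le_trans _ _ _ h₁ h₂ := CuntzLE.trans h₁ h₂

variable (A) in
/-- The Cuntz semigroup `Cu(A)`: Cuntz equivalence classes of positive elements of `A ⊗ 𝒦`, where
`a ∼ b` if `a ≾ b` and `b ≾ a`, ordered by Cuntz subequivalence. -/
def Cu : Type u := Antisymmetrization (PosElt A) (· ≤ ·)

instance instPartialOrderCu : PartialOrder (Cu A) :=
  inferInstanceAs (PartialOrder (Antisymmetrization (PosElt A) (· ≤ ·)))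

/-- The Cuntz class `⟨a⟩` of a positive element `a` of `A ⊗ 𝒦`. -/
def Cu.mk (a : PosElt A) : Cu A := toAntisymmetrization (· ≤ ·) a

theorem Cu.mk_le_mk {a b : PosElt A} : Cu.mk a ≤ Cu.mk b ↔ CuntzLE a.1 b.1 := Iff.rfl

theorem Cu.ind {p : Cu A → Prop} (h : ∀ a, p (Cu.mk a)) (x : Cu A) : p x :=
  Quotient.inductionOn x h

/-- The injection `n ↦ 2n`. -/
def ev (n : ℕ) : ℕ := 2 * n

/-- The injection `n ↦ 2n + 1`. -/
def od (n : ℕ) : ℕ := 2 * n + 1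

theorem ev_injective : ev.Injective := fun m n h => by simp only [ev] at h; omega
theorem od_injective : od.Injective := fun m n h => by simp only [od] at h; omega
theorem ev_ne_od (m n : ℕ) : ev m ≠ od n := by simp only [ev, od]; omega

/-- The orthogonal sum `a ⊕ b` of two positive elements of `A ⊗ 𝒦`, formed in `A ⊗ 𝒦` through the
identification of `ℕ` with two disjoint copies of itself. -/
def PosElt.oplus (a b : PosElt A) : PosElt A :=
  ⟨Stab.relabel ev a.1 + Stab.relabel od b.1, by
    obtain ⟨_, x, rfl⟩ := a
    obtain ⟨_, y, rfl⟩ := b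
    refine ⟨Stab.relabel ev x + Stab.relabel od y, ?_⟩
    have h1 : star (Stab.relabel ev x) * Stab.relabel od y = 0 := by
      rw [← Stab.relabel_star ev_injective]
      exact Stab.relabel_mul_of_disjoint ev_injective od_injective ev_ne_od _ _
    have h2 : star (Stab.relabel od y) * Stab.relabel ev x = 0 := by
      rw [← Stab.relabel_star od_injective]
      exact Stab.relabel_mul_of_disjoint od_injective ev_injective
        (fun i j => (ev_ne_od j i).symm) _ _
    rw [star_add, add_mul, mul_add, mul_add, h1, h2, Stab.relabel_mul ev_injective,
      Stab.relabel_mul od_injective, Stab.relabel_star ev_injective,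
      Stab.relabel_star od_injective, add_zero, zero_add]⟩

theorem PosElt.oplus_le_oplus {a a' b b' : PosElt A} (ha : a ≤ a') (hb : b ≤ b') :
    a.oplus b ≤ a'.oplus b' := by
  intro ε hε
  obtain ⟨x, hx⟩ := ha (ε / 2) (half_pos hε)
  obtain ⟨y, hy⟩ := hb (ε / 2) (half_pos hε)
  refine ⟨Stab.relabel ev x + Stab.relabel od y, ?_⟩
  have hoe : ∀ i j, od i ≠ ev j := fun i j => (ev_ne_od j i).symm
  have h1 : (Stab.relabel ev x + Stab.relabel od y) * (a'.oplus b').1 *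
        star (Stab.relabel ev x + Stab.relabel od y) - (a.oplus b).1 =
      Stab.relabel ev (x * a'.1 * star x - a.1) + Stab.relabel od (y * b'.1 * star y - b.1) := by
    change (Stab.relabel ev x + Stab.relabel od y) * (Stab.relabel ev a'.1 + Stab.relabel od b'.1) *
        star (Stab.relabel ev x + Stab.relabel od y) -
        (Stab.relabel ev a.1 + Stab.relabel od b.1) = _
    rw [Stab.relabel_sub ev_injective, Stab.relabel_sub od_injective,
      Stab.relabel_mul ev_injective, Stab.relabel_mul od_injective,
      Stab.relabel_mul ev_injective, Stab.relabel_mul od_injective, star_add,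
      ← Stab.relabel_star ev_injective, ← Stab.relabel_star od_injective]
    simp only [add_mul, mul_add, mul_assoc,
      Stab.relabel_mul_of_disjoint ev_injective od_injective ev_ne_od,
      Stab.relabel_mul_of_disjoint od_injective ev_injective hoe, mul_zero, add_zero, zero_add]
    abel
  rw [h1]
  have h2 := norm_add_le (Stab.relabel ev (x * a'.1 * star x - a.1))
    (Stab.relabel od (y * b'.1 * star y - b.1))
  have h3 := Stab.norm_relabel_le ev_injective (x * a'.1 * star x - a.1)
  have h4 := Stab.norm_relabel_le od_injective (y * b'.1 * star y - b.1)
  linarith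

/-- Addition in the Cuntz semigroup: `⟨a⟩ + ⟨b⟩ = ⟨a ⊕ b⟩`. -/
instance instAddCu : Add (Cu A) where
  add := Quotient.map₂ PosElt.oplus fun _ _ h _ _ h' =>
    ⟨PosElt.oplus_le_oplus h.1 h'.1, PosElt.oplus_le_oplus h.2 h'.2⟩

theorem Cu.mk_add_mk (a b : PosElt A) : Cu.mk a + Cu.mk b = Cu.mk (a.oplus b) := rfl

instance instZeroCu : Zero (Cu A) where
  zero := Cu.mk ⟨0, 0, by simp⟩

theorem Cu.zero_def : (0 : Cu A) = Cu.mk ⟨0, 0, by simp⟩ := rfl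

theorem Cu.add_comm' (x y : Cu A) : x + y ≤ y + x := by
  induction x using Cu.ind with | _ a
  induction y using Cu.ind with | _ b
  rw [Cu.mk_add_mk, Cu.mk_add_mk, Cu.mk_le_mk]
  have h := CuntzLE.sum_relabel (A := A) ![ev, od] ![od, ev]
    (by simp [Fin.forall_fin_two, ev_injective, od_injective])
    (by simp [Fin.forall_fin_two, ev_injective, od_injective])
    (by
      simp only [Fin.forall_fin_two]
      refine ⟨⟨by simp, fun _ m n => (ev_ne_od n m).symm⟩, fun _ m n => ev_ne_od m n, by simp⟩)
    ![a.1, b.1]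
  simp only [Fin.sum_univ_two] at h
  refine h.trans ?_
  rw [add_comm]
  exact CuntzLE.refl _

theorem Cu.zero_add' (x : Cu A) : 0 + x = x := by
  induction x using Cu.ind with | _ a
  have h0 : (PosElt.oplus ⟨0, 0, by simp⟩ a).1 = Stab.relabel od a.1 := by
    change Stab.relabel ev 0 + Stab.relabel od a.1 = _
    rw [Stab.relabel_zero ev_injective, zero_add]
  rw [Cu.zero_def, Cu.mk_add_mk]
  apply le_antisymm
  · rw [Cu.mk_le_mk, h0]
    have h := CuntzLE.sum_relabel (A := A) (fun _ : Unit => od) (fun _ => id)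
      (fun _ => od_injective) (fun _ => Function.injective_id)
      (fun j k hjk => absurd (Subsingleton.elim j k) hjk) (fun _ => a.1)
    simpa [Stab.relabel_id] using h
  · rw [Cu.mk_le_mk, h0]
    have h := CuntzLE.sum_relabel (A := A) (fun _ : Unit => id) (fun _ => od)
      (fun _ => Function.injective_id) (fun _ => od_injective)
      (fun j k hjk => absurd (Subsingleton.elim j k) hjk) (fun _ => a.1)
    simpa [Stab.relabel_id] using h

theorem Cu.add_assoc' (x y z : Cu A) : x + y + z = x + (y + z) := by
  induction x using Cu.ind with | _ a
  induction y using Cu.ind with | _ b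
  induction z using Cu.ind with | _ c
  have hl : ((a.oplus b).oplus c).1 = Stab.relabel (ev ∘ ev) a.1 + Stab.relabel (ev ∘ od) b.1 +
      Stab.relabel od c.1 := by
    change Stab.relabel ev (Stab.relabel ev a.1 + Stab.relabel od b.1) + Stab.relabel od c.1 = _
    rw [Stab.relabel_add ev_injective, Stab.relabel_comp ev_injective ev_injective,
      Stab.relabel_comp ev_injective od_injective]
  have hr : (a.oplus (b.oplus c)).1 = Stab.relabel ev a.1 + Stab.relabel (od ∘ ev) b.1 +
      Stab.relabel (od ∘ od) c.1 := by
    change Stab.relabel ev a.1 + Stab.relabel od (Stab.relabel ev b.1 + Stab.relabel od c.1) = _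
    rw [Stab.relabel_add od_injective, Stab.relabel_comp od_injective ev_injective,
      Stab.relabel_comp od_injective od_injective, add_assoc]
  have i1 : ∀ j, (![ev ∘ ev, ev ∘ od, od] j).Injective := by
    simp [Fin.forall_fin_succ, ev_injective, od_injective, ev_injective.comp]
  have i2 : ∀ j, (![ev, od ∘ ev, od ∘ od] j).Injective := by
    simp [Fin.forall_fin_succ, ev_injective, od_injective, od_injective.comp]
  have d1 : ∀ j k, j ≠ k → ∀ m n, ![ev ∘ ev, ev ∘ od, od] j m ≠ ![ev ∘ ev, ev ∘ od, od] k n := by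
    intro j k hjk m n
    fin_cases j <;> fin_cases k <;> simp [ev, od] at hjk ⊢ <;> omega
  have d2 : ∀ j k, j ≠ k → ∀ m n, ![ev, od ∘ ev, od ∘ od] j m ≠ ![ev, od ∘ ev, od ∘ od] k n := by
    intro j k hjk m n
    fin_cases j <;> fin_cases k <;> simp [ev, od] at hjk ⊢ <;> omega
  simp only [Cu.mk_add_mk]
  apply le_antisymm
  · rw [Cu.mk_le_mk, hl, hr]
    have h := CuntzLE.sum_relabel (A := A) _ _ i1 i2 d2 ![a.1, b.1, c.1]
    simpa [Fin.sum_univ_three] using h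
  · rw [Cu.mk_le_mk, hl, hr]
    have h := CuntzLE.sum_relabel (A := A) _ _ i2 i1 d1 ![a.1, b.1, c.1]
    simpa [Fin.sum_univ_three] using h

instance instAddCommMonoidCu : AddCommMonoid (Cu A) where
  add_assoc := Cu.add_assoc'
  zero_add := Cu.zero_add'
  add_zero x := (le_antisymm (Cu.add_comm' x 0) (Cu.add_comm' 0 x)).trans (Cu.zero_add' x)
  add_comm x y := le_antisymm (Cu.add_comm' x y) (Cu.add_comm' y x)
  nsmul := nsmulRec

variable (A) in
/-- The class `⟨1_A⟩` of the unit of `A` in `Cu(A)`, with `A` embedded in `A ⊗ 𝒦` through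
`a ↦ a ⊗ e₀₀`. -/
def unitClass : Cu A :=
  Cu.mk ⟨Stab.single 0 0 1, Stab.single 0 0 1, by simp [Stab.star_single, Stab.single_mul_single]⟩

end Cuntz

/-! ## Divisibility numbers -/

section Divisibility

variable {S : Type u} [PartialOrder S] [AddCommMonoid S]

/-- Compact containment `u ≪ v`: whenever `v = sup vᵢ` for an increasing sequence `(vᵢ)`, then
`u ≤ vᵢ` for some `i`. -/
def CompactlyContained (u v : S) : Prop :=
  ∀ w : ℕ → S, Monotone w → IsLUB (Set.range w) v → ∃ i, u ≤ w i

/-- `u` is `(m, n)`-divisible. -/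
def IsDivisible (m n : ℕ) (u : S) : Prop :=
  ∀ u', CompactlyContained u' u → ∃ x : S, m • x ≤ u ∧ u' ≤ n • x

/-- `u` is `(m, n)`-decomposable. -/
def IsDecomposable (m n : ℕ) (u : S) : Prop :=
  ∀ u', CompactlyContained u' u → ∃ x : Fin m → S, ∑ j, x j ≤ u ∧ ∀ j, u' ≤ n • x j

/-- `u` is weakly `(m, n)`-divisible. -/
def IsWeaklyDivisible (m n : ℕ) (u : S) : Prop :=
  ∀ u', CompactlyContained u' u → ∃ x : Fin n → S, (∀ j, m • x j ≤ u) ∧ u' ≤ ∑ j, x j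

end Divisibility

section Numbers

/-- The least integer `n ≥ 1` with `p n`, and `∞` if there is none. -/
def leastPos (p : ℕ → Prop) : ℕ∞ := sInf {N : ℕ∞ | ∃ n : ℕ, 1 ≤ n ∧ p n ∧ N = n}

/-- The number `Div_m(A)`, the least `n ≥ 1` such that `⟨1_A⟩` is `(m, n)`-divisible. -/
def bigDiv (m : ℕ) (A : Type u) [CStarAlgebra A] : ℕ∞ :=
  leastPos fun n => IsDivisible m n (unitClass A)

/-- The number `∂iv_m(A)`, the least `n ≥ 1` such that `⟨1_A⟩` is `(m, n)`-decomposable. -/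
def decDiv (m : ℕ) (A : Type u) [CStarAlgebra A] : ℕ∞ :=
  leastPos fun n => IsDecomposable m n (unitClass A)

/-- The number `div_m(A)`, the least `n ≥ 1` such that `⟨1_A⟩` is weakly `(m, n)`-divisible. -/
def weakDiv (m : ℕ) (A : Type u) [CStarAlgebra A] : ℕ∞ :=
  leastPos fun n => IsWeaklyDivisible m n (unitClass A)

end Numbers

end CuntzDiv

end

/-!
Each of the three divisibility properties of `⟨1⟩` asks for a solution of a finite system of
inequalities `∑ₛ x (φ p s) ≤ ⟨1⟩ ≤ ∑ₜ x (ψ q t)` in the Cuntz semigroup; here `⟨1⟩ ≪ ⟨1⟩` makes it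
unnecessary to pass to elements `u' ≪ ⟨1⟩`. By cutting down and rescaling, a solution in `Cu(A)`
gives elements of `A` itself, of norm at most `2`, that satisfy finitely many `*`-polynomial
relations up to any prescribed error. Conversely these relations are stable: there is an error,
depending only on the lengths of the sums and on the norm bound, such that every approximate
solution yields an exact solution in `Cu(A)`. Bounded approximate solutions can be assembled into
elements of the product and lifted from the quotient, so solvability in `∏ A_k` means solvability
in all `A_k`, and solvability in `∏_ω A_k` means solvability in `A_k` for `ω`-almost all `k`.
-/

namespace CuntzDiv

universe u

section Order

attribute [local instance] CStarAlgebra.spectralOrder CStarAlgebra.spectralOrderedRing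

theorem exists_isSelfAdjoint_conj_add_smul_eq_one {M : Type u} [CStarAlgebra M] {b : M} (hb : 0 ≤ b)
    {δ : ℝ} (hδ : 0 < δ) :
    ∃ k : M, IsSelfAdjoint k ∧ k * b * k + δ • (k * k) = 1 := by
  have hpos : ∀ t ∈ spectrum ℝ b, 0 < t + δ := fun t ht =>
    add_pos_of_nonneg_of_pos (spectrum_nonneg_of_nonneg hb ht) hδ
  have hcont : ContinuousOn (fun t : ℝ => 1 / √(t + δ)) (spectrum ℝ b) :=
    continuousOn_const.div (by fun_prop) fun t ht => (Real.sqrt_pos.2 (hpos t ht)).ne'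
  refine ⟨cfc (fun t : ℝ => 1 / √(t + δ)) b, cfc_predicate _ _, ?_⟩
  nth_rewrite 2 [← cfc_id' ℝ b]
  rw [← cfc_mul _ _ b hcont (by fun_prop), ← cfc_mul _ _ b (by fun_prop) hcont,
    ← cfc_mul _ _ b hcont hcont, ← cfc_smul δ _ b (by fun_prop),
    ← cfc_add b _ _ (by fun_prop) (by fun_prop), ← cfc_one ℝ b]
  refine cfc_congr fun t ht => ?_
  have hsq : √(t + δ) ^ 2 = t + δ := Real.sq_sqrt (hpos t ht).le
  have hne : √(t + δ) ≠ 0 := (Real.sqrt_pos.2 (hpos t ht)).ne'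
  simp only [smul_eq_mul, Pi.one_apply]
  field_simp
  rw [hsq]

theorem exists_norm_mul_conj_sub_le {M : Type u} [CStarAlgebra M] {s b : M}
    (h : star s * s ≤ b) {δ : ℝ} (hδ : 0 < δ) :
    ∃ k : M, ‖s * k * b * star (s * k) - s * star s‖ ≤ δ := by
  have hb : 0 ≤ b := (star_mul_self_nonneg s).trans h
  obtain ⟨k, hk, hone⟩ := exists_isSelfAdjoint_conj_add_smul_eq_one hb hδ
  have hkbk : k * b * k ≤ 1 := by
    rw [← hone]
    exact le_add_of_nonneg_right (smul_nonneg hδ.le hk.mul_self_nonneg)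
  have hdefect : s * k * b * star (s * k) - s * star s = -(δ • (s * k * star (s * k))) := by
    calc _ = s * (k * b * k - 1) * star s := by
          simp only [star_mul, hk.star_eq, mul_sub, sub_mul, mul_one, mul_assoc]
      _ = _ := by
          rw [← hone]
          simp only [star_mul, hk.star_eq, sub_add_cancel_left, mul_neg, neg_mul, mul_smul_comm,
            smul_mul_assoc, mul_assoc]
  have hconj : star (s * k) * (s * k) = k * (star s * s) * k := by
    simp only [star_mul, hk.star_eq, mul_assoc]
  have hnorm : ‖s * k * star (s * k)‖ ≤ 1 := by
    rw [CStarRing.norm_self_mul_star, ← CStarRing.norm_star_mul_self,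
      CStarAlgebra.norm_le_one_iff_of_nonneg _ (star_mul_self_nonneg _), hconj]
    exact (hk.conjugate_le_conjugate h).trans hkbk
  refine ⟨k, ?_⟩
  rw [hdefect, norm_neg, norm_smul, Real.norm_of_nonneg hδ.le]
  exact mul_le_of_le_one_right hδ.le hnorm

variable {B : Type u} [NonUnitalCStarAlgebra B]

theorem exists_norm_conj_sub_le {s b : B} (h : star s * s ≤ b)
    {δ : ℝ} (hδ : 0 < δ) : ∃ x : B, ‖x * b * star x - s * star s‖ ≤ δ := by
  have hb : IsSelfAdjoint b := .of_nonneg ((star_mul_self_nonneg s).trans h)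
  have hU : star (s : Unitization ℂ B) * s ≤ b := by
    exact_mod_cast (Unitization.inr_le_iff _ _).2 h
  obtain ⟨k, hk⟩ := exists_norm_mul_conj_sub_le hU hδ
  obtain ⟨x, hx⟩ : ∃ x : B, (x : Unitization ℂ B) = s * k :=
    ⟨(s * k : Unitization ℂ B).snd, Unitization.ext (by simp) (by simp)⟩
  refine ⟨x, ?_⟩
  rw [← hx] at hk
  rw [← Unitization.norm_inr (𝕜 := ℂ)]
  exact_mod_cast hk

variable {A : Type u} [CStarAlgebra A]

theorem CuntzLE.conj (x b : Stab A) : CuntzLE (x * b * star x) b :=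
  fun ε hε => ⟨x, by simpa using hε⟩

theorem CuntzLE.of_star_mul_self_le {s b : Stab A} (h : star s * s ≤ b) :
    CuntzLE (s * star s) b := fun _ hε =>
  (exists_norm_conj_sub_le h (half_pos hε)).imp fun _ hx =>
    hx.trans_lt (half_lt_self hε)

theorem CuntzLE.of_le {a b : Stab A} (ha : 0 ≤ a) (hab : a ≤ b) : CuntzLE a b := by
  have hs : IsSelfAdjoint (CFC.sqrt a) := (CFC.sqrt_nonneg a).isSelfAdjoint
  have h := CuntzLE.of_star_mul_self_le (s := CFC.sqrt a) (b := b)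
  rw [hs.star_eq, CFC.sqrt_mul_sqrt_self a ha] at h
  exact h hab

theorem CuntzLE.conj_sub_smul_of_norm_sub_le {a b : Stab A} {κ : ℝ} (hab : IsSelfAdjoint (a - b))
    (h : ‖a - b‖ ≤ κ) (g : Stab A) (hpos : 0 ≤ g * a * star g - κ • (g * star g)) :
    CuntzLE (g * a * star g - κ • (g * star g)) b := by
  refine (CuntzLE.of_le hpos ?_).trans (CuntzLE.conj g b)
  rw [sub_le_comm, ← sub_mul, ← mul_sub]
  calc g * (a - b) * star g ≤ ‖a - b‖ • (g * star g) :=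
        CStarAlgebra.star_right_conjugate_le_norm_smul hab
    _ ≤ κ • (g * star g) := smul_le_smul_of_nonneg_right h (mul_star_self_nonneg g)

end Order

section Compactness

attribute [local instance] CStarAlgebra.spectralOrder CStarAlgebra.spectralOrderedRing

variable {A : Type u} [CStarAlgebra A]

theorem CuntzLE.of_isStarProjection {p b : Stab A} (hp : IsStarProjection p)
    (hb : IsSelfAdjoint b) (h : ‖p - b‖ < 1) : CuntzLE p b := by
  set κ := ‖p - b‖
  have hκ : 0 < 1 - κ := sub_pos.2 h
  have hscale : (√(1 - κ))⁻¹ * (√(1 - κ))⁻¹ * (1 - κ) = 1 := by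
    rw [← mul_inv, Real.mul_self_sqrt hκ.le, inv_mul_cancel₀ hκ.ne']
  have hp' : star p = p := hp.isSelfAdjoint.star_eq
  have hconj : ((√(1 - κ))⁻¹ • p) * p * star ((√(1 - κ))⁻¹ • p) -
      κ • (((√(1 - κ))⁻¹ • p) * star ((√(1 - κ))⁻¹ • p)) = p := by
    simp only [star_smul, star_trivial, hp', smul_mul_assoc, mul_smul_comm, hp.isIdempotentElem.eq,
      smul_smul, ← sub_smul]
    rw [← one_smul ℝ p, smul_smul]
    congr 1
    linear_combination hscale
  have key := CuntzLE.conj_sub_smul_of_norm_sub_le (hp.isSelfAdjoint.sub hb) le_rfl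
    ((√(1 - κ))⁻¹ • p)
  rw [hconj] at key
  exact key hp.nonneg

theorem Stab.isStarProjection_single_one (A : Type u) [CStarAlgebra A] :
    IsStarProjection (single 0 0 (1 : A)) :=
  ⟨by simp [IsIdempotentElem, single_mul_single], by simp [IsSelfAdjoint, star_single]⟩

theorem Stab.tendsto_conj_proj (x : Stab A) :
    Tendsto (fun n => shift A id n * x * shift A id n) atTop (𝓝 x) := by
  simpa only [relabel_id, star_proj] using tendsto_relabel Function.injective_id x

theorem Stab.star_shift_add_mul_proj (n M : ℕ) :
    star (shift A (· + n) M) * shift A id n = 0 := by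
  rw [star_shift, shift, Finset.sum_mul_sum]
  refine Finset.sum_eq_zero fun i _ => Finset.sum_eq_zero fun j hj => ?_
  have hij : i + n ≠ id j := by
    have := Finset.mem_range.1 hj
    simp only [id]
    omega
  rw [single_mul_single, if_neg hij]

theorem isOpen_exists_norm_conj_sub_lt (a : Stab A) (ε : ℝ) :
    IsOpen {c : Stab A | ∃ x, ‖x * c * star x - a‖ < ε} := by
  simp only [Set.ofPred_exists]
  exact isOpen_iUnion fun x => isOpen_lt (by fun_prop) continuous_const

/- If `y` conjugates `c` into `U`, so does `y + r S` for small `r`, where `S` is a partial isometry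
with range orthogonal to the range of `y`; and `r⁻¹ S⋆` then recovers `c`. -/
theorem CuntzLE.exists_conj_mem_conj_mem {b c : Stab A} (h : CuntzLE b c) {U V : Set (Stab A)}
    (hU : IsOpen U) (hbU : b ∈ U) (hV : IsOpen V) (hcV : c ∈ V) :
    ∃ v t : Stab A, v * c * star v ∈ U ∧ t * (v * c * star v) * star t ∈ V := by
  obtain ⟨ε, hε, hεU⟩ := Metric.isOpen_iff.1 hU b hbU
  obtain ⟨x, hx⟩ := h ε hε
  have hxU : x * c * star x ∈ U := hεU (by rwa [Metric.mem_ball, dist_eq_norm])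
  obtain ⟨n, hn⟩ := ((Stab.tendsto_conj_proj (x * c * star x)).eventually (hU.mem_nhds hxU)).exists
  obtain ⟨M, hM⟩ := ((Stab.tendsto_conj_proj c).eventually (hV.mem_nhds hcV)).exists
  let y := Stab.shift A id n * x
  let S := Stab.shift A (· + n) M
  have hSy : star S * y = 0 := by
    rw [← mul_assoc, Stab.star_shift_add_mul_proj, zero_mul]
  have hSS : star S * S = Stab.shift A id M :=
    Stab.star_shift_mul_shift (add_left_injective n) le_rfl
  have hcont : Continuous fun r : ℂ => (y + r • S) * c * star (y + r • S) := by fun_prop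
  have hyU : (y + (0 : ℂ) • S) * c * star (y + (0 : ℂ) • S) ∈ U := by
    have hy : y * c * star y = Stab.shift A id n * (x * c * star x) * Stab.shift A id n := by
      simp only [y, star_mul, Stab.star_proj, mul_assoc]
    rw [zero_smul, add_zero, hy]
    exact hn
  have hev : ∀ᶠ r : ℂ in 𝓝[≠] 0, (y + r • S) * c * star (y + r • S) ∈ U :=
    (hcont.continuousAt.eventually (hU.mem_nhds hyU)).filter_mono nhdsWithin_le_nhds
  obtain ⟨r, hrU, hr⟩ := (hev.and self_mem_nhdsWithin).exists
  have hrecover : (r⁻¹ • star S) * (y + r • S) = Stab.shift A id M := by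
    rw [mul_add, smul_mul_assoc, hSy, smul_zero, zero_add, smul_mul_smul_comm, hSS,
      inv_mul_cancel₀ hr, one_smul]
  refine ⟨y + r • S, r⁻¹ • star S, hrU, ?_⟩
  have hconj : r⁻¹ • star S * ((y + r • S) * c * star (y + r • S)) * star (r⁻¹ • star S) =
      (r⁻¹ • star S * (y + r • S)) * c * star (r⁻¹ • star S * (y + r • S)) := by
    simp only [star_mul, mul_assoc]
  rwa [hconj, hrecover, Stab.star_proj]

theorem PosElt.exists_eq_star_mul_self_of_mem_closure (a : ℕ → PosElt A) {s : Stab A}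
    (hs : s ∈ closure {b | ∃ n v, b = v * (a n).1 * star v}) : ∃ c, s = star c * c := by
  rw [← CStarAlgebra.nonneg_iff_eq_star_mul_self]
  refine closure_minimal ?_ CStarAlgebra.isClosed_nonneg hs
  rintro _ ⟨n, v, rfl⟩
  exact star_right_conjugate_nonneg (CStarAlgebra.nonneg_iff_eq_star_mul_self.2 (a n).pos) v

/- By the Baire category theorem: dominating a given `a i` up to a given error is an open dense
condition on the closure of the set of conjugates of the `a n`. -/
theorem PosElt.exists_upper_bound_mem_closure (a : ℕ → PosElt A) (ha : Monotone a) :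
    ∃ s : PosElt A, (∀ i, a i ≤ s) ∧ s.1 ∈ closure {b | ∃ n v, b = v * (a n).1 * star v} := by
  let X := closure {b | ∃ n v, b = v * (a n).1 * star v}
  have : CompleteSpace X := isClosed_closure.completeSpace_coe
  have : Nonempty X := ⟨⟨0, subset_closure ⟨0, 0, by simp⟩⟩⟩
  let O : ℕ × ℕ → Set (Stab A) := fun p =>
    {c | ∃ x, ‖x * c * star x - (a p.1).1‖ < 1 / ((p.2 : ℝ) + 1)}
  have hO : ∀ p, IsOpen (O p) := fun p => isOpen_exists_norm_conj_sub_lt _ _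
  have hdense : ∀ p, Dense ((↑) ⁻¹' O p : Set X) := by
    refine fun p => dense_iff_inter_open.2 ?_
    rintro _ ⟨U, hU, rfl⟩ ⟨c, hcU⟩
    obtain ⟨_, hbU, n, v, rfl⟩ := mem_closure_iff.1 c.2 U hU hcU
    have hle : CuntzLE (v * (a n).1 * star v) (a (max n p.1)).1 :=
      (CuntzLE.conj _ _).trans (ha (le_max_left n p.1))
    obtain ⟨v', t, hU', x, hx⟩ := hle.exists_conj_mem_conj_mem hU hbU (hO p)
      (ha (le_max_right n p.1) _ Nat.one_div_pos_of_nat)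
    refine ⟨⟨_, subset_closure ⟨max n p.1, v', rfl⟩⟩, hU', x * t, ?_⟩
    simpa only [star_mul, mul_assoc] using hx
  obtain ⟨s, hs⟩ := (dense_iInter_of_isOpen
    (fun p => (hO p).preimage continuous_subtype_val) hdense).nonempty
  refine ⟨⟨s, exists_eq_star_mul_self_of_mem_closure a s.2⟩, fun i ε hε => ?_, s.2⟩
  obtain ⟨k, hk⟩ := exists_nat_one_div_lt hε
  exact (Set.mem_iInter.1 hs (i, k)).imp fun _ hx => hx.trans hk

theorem Cu.mk_surjective : Function.Surjective (Cu.mk : PosElt A → Cu A) := Quotient.mk_surjective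

theorem compactlyContained_unitClass : CompactlyContained (unitClass A) (unitClass A) := by
  intro w hw hlub
  choose a ha using fun n => Cu.mk_surjective (w n)
  obtain ⟨s, has, hs⟩ := PosElt.exists_upper_bound_mem_closure a fun i j hij => by
    change Cu.mk (a i) ≤ Cu.mk (a j)
    rw [ha, ha]
    exact hw hij
  have hle : unitClass A ≤ Cu.mk s := hlub.2 (by
    rintro _ ⟨n, rfl⟩
    exact ha n ▸ has n)
  obtain ⟨x, hx⟩ := (Cu.mk_le_mk.1 hle) 1 one_pos
  have hopen : IsOpen {c : Stab A | ‖x * c * star x - Stab.single 0 0 1‖ < 1} :=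
    isOpen_lt (by fun_prop) continuous_const
  obtain ⟨_, hb, n, v, rfl⟩ := mem_closure_iff.1 hs _ hopen hx
  refine ⟨n, (ha n).symm ▸ Cu.mk_le_mk.2 ?_⟩
  have hsa : IsSelfAdjoint (a n).1 := by
    obtain ⟨c, hc⟩ := (a n).pos
    exact hc ▸ .star_mul_self c
  refine (CuntzLE.of_isStarProjection (Stab.isStarProjection_single_one A)
    ((hsa.conjugate v).conjugate x) ?_).trans ((CuntzLE.conj x _).trans (CuntzLE.conj v _))
  rwa [norm_sub_rev]

end Compactness

section Corner

attribute [local instance] CStarAlgebra.spectralOrder CStarAlgebra.spectralOrderedRing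

variable {A : Type u} [CStarAlgebra A]

theorem norm_le_norm_tensorUnit (i j : ℕ) (a : A) : ‖a‖ ≤ ‖tensorUnit i j a‖ := by
  refine le_of_forall_gt_imp_ge_of_dense fun r hr => ?_
  obtain ⟨n, hn, hi, hj⟩ := ((RProd.eventually_lt hr).and
    ((eventually_gt_atTop i).and (eventually_gt_atTop j))).exists
  have hentry : (MatN.single n i j a).entry ⟨i, hi⟩ ⟨j, hj⟩ = a := if_pos ⟨rfl, rfl⟩
  calc ‖a‖ = ‖(MatN.single n i j a).entry ⟨i, hi⟩ ⟨j, hj⟩‖ := by rw [hentry]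
    _ ≤ ‖MatN.single n i j a‖ :=
        CStarMatrix.norm_entry_le_norm
          (M := (MatN.single n i j a : CStarMatrix (Fin n) (Fin n) A))
    _ ≤ r := hn.le

variable (A) in
/-- The embedding `a ↦ a ⊗ e₀₀` of `A` as a corner of `A ⊗ 𝒦`. -/
noncomputable def corner : A →⋆ₙₐ[ℂ] Stab A where
  toFun := Stab.single 0 0
  map_smul' := Stab.single_smul 0 0
  map_zero' := Stab.single_zero 0 0
  map_add' := Stab.single_add 0 0
  map_mul' a b := by rw [Stab.single_mul_single, if_pos rfl]
  map_star' a := (Stab.star_single 0 0 a).symm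

theorem norm_corner (a : A) : ‖corner A a‖ = ‖a‖ :=
  (Stab.norm_single_le 0 0 a).antisymm (norm_le_norm_tensorUnit 0 0 a)

theorem isometry_corner : Isometry (corner A) :=
  AddMonoidHomClass.isometry_of_norm (corner A) norm_corner

theorem exists_eq_tensorUnit_of_mem_closure {y : MatSeq A} (hy : y ∈ Subsemigroup.closure
    ({x | ∃ i j a, x = tensorUnit i j a} ∪ star {x | ∃ i j a, x = tensorUnit i j a})) :
    ∃ i j a, y = tensorUnit (A := A) i j a := by
  induction hy using Subsemigroup.closure_induction with
  | mem y hy =>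
    rcases hy with hy | ⟨i, j, a, hy⟩
    · exact hy
    · refine ⟨j, i, star a, ?_⟩
      rw [← star_star y, hy]
      exact congrArg Subtype.val (Stab.star_single i j a)
  | mul y z _ _ hy hz =>
    obtain ⟨i, j, a, rfl⟩ := hy
    obtain ⟨k, l, b, rfl⟩ := hz
    have hmul := congrArg Subtype.val (Stab.single_mul_single i j k l a b)
    split_ifs at hmul
    · exact ⟨i, l, a * b, hmul⟩
    · exact ⟨0, 0, 0, hmul.trans (congrArg Subtype.val (Stab.single_zero 0 0)).symm⟩

theorem Stab.dense_span_single :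
    Dense (Submodule.span ℂ {x : Stab A | ∃ i j a, x = single i j a} : Set (Stab A)) := by
  intro x
  refine Metric.mem_closure_iff.2 fun ε hε => ?_
  obtain ⟨y, hy, hxy⟩ := Metric.mem_closure_iff.1 x.2 ε hε
  refine ⟨⟨y, NonUnitalStarSubalgebra.le_topologicalClosure _ hy⟩, ?_, hxy⟩
  have hy' := (NonUnitalStarAlgebra.adjoin_eq_span (R := ℂ)
    {x : MatSeq A | ∃ i j a, x = tensorUnit i j a}).le hy
  clear hxy
  induction hy' using Submodule.span_induction with
  | mem y hy' =>
    obtain ⟨i, j, a, rfl⟩ := exists_eq_tensorUnit_of_mem_closure hy'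
    exact Submodule.subset_span ⟨i, j, a, rfl⟩
  | zero => exact zero_mem _
  | add y z hy₀ hz₀ h₁ h₂ =>
    rw [← NonUnitalStarAlgebra.adjoin_eq_span] at hy₀ hz₀
    exact add_mem (h₁ hy₀) (h₂ hz₀)
  | smul r y hy₀ h =>
    rw [← NonUnitalStarAlgebra.adjoin_eq_span] at hy₀
    exact Submodule.smul_mem _ r (h hy₀)

theorem exists_corner_eq_conj (z : Stab A) : ∃ a, corner A a = corner A 1 * z * corner A 1 := by
  let S : Submodule ℂ (Stab A) := (LinearMap.range (corner A : A →ₗ[ℂ] Stab A)).comap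
    (LinearMap.mulLeftRight ℂ (corner A 1, corner A 1))
  have hclosed : IsClosed (S : Set (Stab A)) := by
    have hrange : IsClosed (Set.range (corner A)) :=
      isometry_corner.isClosedEmbedding.isClosed_range
    exact hrange.preimage (f := fun z => corner A 1 * z * corner A 1) (by fun_prop)
  have hspan : Submodule.span ℂ {x : Stab A | ∃ i j a, x = Stab.single i j a} ≤ S := by
    refine Submodule.span_le.2 ?_
    rintro _ ⟨i, j, a, rfl⟩
    change Stab.single 0 0 1 * Stab.single i j a * Stab.single 0 0 1 ∈
      LinearMap.range (corner A : A →ₗ[ℂ] Stab A)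
    simp only [Stab.single_mul_single, one_mul, ite_mul, zero_mul, mul_one]
    split_ifs
    · exact ⟨a, rfl⟩
    · exact zero_mem _
    · exact zero_mem _
  exact closure_minimal hspan hclosed (Stab.dense_span_single z)

/-- The compression `A ⊗ 𝒦 → A` to the upper left corner, `∑ aᵢⱼ ⊗ eᵢⱼ ↦ a₀₀`. -/
noncomputable def compress (z : Stab A) : A := (exists_corner_eq_conj z).choose

theorem corner_compress (z : Stab A) : corner A (compress z) = corner A 1 * z * corner A 1 :=
  (exists_corner_eq_conj z).choose_spec

end Corner

section Sums

theorem tendsto_mul_mul_of_norm_le_one {R : Type*} [NonUnitalNormedRing R] {u v y : ℕ → R}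
    {z l : R} (hu : ∀ n, ‖u n‖ ≤ 1) (hv : ∀ n, ‖v n‖ ≤ 1) (hy : Tendsto y atTop (𝓝 z))
    (hz : Tendsto (fun n => u n * z * v n) atTop (𝓝 l)) :
    Tendsto (fun n => u n * y n * v n) atTop (𝓝 l) := by
  have hsub : Tendsto (fun n => u n * (y n - z) * v n) atTop (𝓝 0) := by
    refine squeeze_zero_norm (fun n => ?_) (tendsto_iff_norm_sub_tendsto_zero.1 hy)
    calc ‖u n * (y n - z) * v n‖ ≤ ‖u n‖ * ‖y n - z‖ * ‖v n‖ := norm_mul₃_le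
      _ ≤ 1 * ‖y n - z‖ * 1 := by gcongr <;> apply_assumption
      _ = ‖y n - z‖ := by rw [one_mul, mul_one]
  simpa only [mul_sub, sub_mul, sub_add_cancel, zero_add] using hsub.add hz

variable {A : Type u} [CStarAlgebra A]

theorem CuntzLE.exists_tendsto {a b : Stab A} (h : CuntzLE a b) :
    ∃ x : ℕ → Stab A, Tendsto (fun n => x n * b * star (x n)) atTop (𝓝 a) := by
  choose x hx using fun n : ℕ => h (1 / ((n : ℝ) + 1)) Nat.one_div_pos_of_nat
  exact ⟨x, tendsto_iff_norm_sub_tendsto_zero.2 <| squeeze_zero (fun _ => norm_nonneg _)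
    (fun n => (hx n).le) tendsto_one_div_add_atTop_nhds_zero_nat⟩

/-- Injections `ℕ → ℕ` with pairwise disjoint ranges: `slot s` describes the place of the summand
`aₛ` in the iterated orthogonal sum `a₀ ⊕ (a₁ ⊕ (a₂ ⊕ ⋯))`. -/
def slot : ℕ → ℕ → ℕ
  | 0 => ev
  | s + 1 => od ∘ slot s

theorem slot_injective : ∀ s, (slot s).Injective
  | 0 => ev_injective
  | s + 1 => od_injective.comp (slot_injective s)

theorem slot_ne_slot : ∀ {s t : ℕ}, s ≠ t → ∀ i j, slot s i ≠ slot t j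
  | 0, 0, h, _, _ => absurd rfl h
  | 0, _ + 1, _, i, _ => ev_ne_od i _
  | _ + 1, 0, _, _, j => (ev_ne_od j _).symm
  | _ + 1, _ + 1, h, i, j => od_injective.ne (slot_ne_slot (mt (congrArg _) h) i j)

theorem exists_mk_eq_sum_mk {m : ℕ} (a : Fin m → PosElt A) : ∃ c : PosElt A,
    c.1 = ∑ s : Fin m, Stab.relabel (slot s) (a s).1 ∧ Cu.mk c = ∑ s, Cu.mk (a s) := by
  induction m with
  | zero => exact ⟨⟨0, 0, by simp⟩, by simp, by simp [Cu.zero_def]⟩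
  | succ m ih =>
    obtain ⟨c, hc, hmk⟩ := ih fun s => a s.succ
    let od' : Stab A →+ Stab A :=
      AddMonoidHom.mk' (Stab.relabel od) (Stab.relabel_add od_injective)
    refine ⟨(a 0).oplus c, ?_, ?_⟩
    · rw [Fin.sum_univ_succ]
      change Stab.relabel ev (a 0).1 + od' c.1 = Stab.relabel ev (a 0).1 + _
      rw [hc, map_sum]
      exact congrArg _ (Finset.sum_congr rfl fun s _ =>
        Stab.relabel_comp od_injective (slot_injective s) _)
    · rw [Fin.sum_univ_succ, ← hmk, Cu.mk_add_mk]

variable {m : ℕ}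

theorem Stab.star_shift_mul_sum_relabel_mul_shift (a : Fin m → Stab A) (n : ℕ) (s s' : Fin m) :
    star (shift A (slot s) n) * (∑ k : Fin m, relabel (slot k) (a k)) * shift A (slot s') n =
      if s = s' then shift A id n * a s * shift A id n else 0 := by
  rw [Finset.mul_sum, Finset.sum_eq_single s]
  · split_ifs with h
    · subst h
      exact star_shift_mul_relabel (slot_injective s) n (a s)
    · have hzero := star_shift_mul_relabel_of_disjoint (slot_injective s)
        (slot_ne_slot (Fin.val_ne_of_ne (Ne.symm h))) n (star (a s))
      rw [relabel_star (slot_injective s), ← star_mul, star_eq_zero] at hzero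
      rw [mul_assoc, hzero, mul_zero]
  · exact fun k _ hk => star_shift_mul_relabel_of_disjoint (slot_injective k)
      (slot_ne_slot (Fin.val_ne_of_ne hk.symm)) n _
  · simp

theorem Stab.norm_star_shift_le {f : ℕ → ℕ} (hf : f.Injective) (n : ℕ) :
    ‖star (shift A f n)‖ ≤ 1 :=
  (norm_star _).trans_le (norm_shift_le hf n)

theorem sum_mk_le_mk_iff (a : Fin m → PosElt A) (b : PosElt A) :
    ∑ s, Cu.mk (a s) ≤ Cu.mk b ↔ ∃ x : ℕ → Fin m → Stab A, ∀ s s',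
      Tendsto (fun n => x n s * b.1 * star (x n s')) atTop (𝓝 (if s = s' then (a s).1 else 0)) := by
  obtain ⟨c, hc, hsum⟩ := exists_mk_eq_sum_mk a
  rw [← hsum, Cu.mk_le_mk, hc]
  constructor
  · intro h
    obtain ⟨x, hx⟩ := h.exists_tendsto
    refine ⟨fun n s => star (Stab.shift A (slot s) n) * x n, fun s s' => ?_⟩
    have hlim : Tendsto (fun n => star (Stab.shift A (slot s) n) *
        (∑ k : Fin m, Stab.relabel (slot k) (a k).1) * Stab.shift A (slot s') n) atTop
        (𝓝 (if s = s' then (a s).1 else 0)) := by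
      simp only [Stab.star_shift_mul_sum_relabel_mul_shift]
      split_ifs
      · exact Stab.tendsto_conj_proj (a s).1
      · exact tendsto_const_nhds
    simpa only [star_mul, star_star, mul_assoc] using
      tendsto_mul_mul_of_norm_le_one (Stab.norm_star_shift_le (slot_injective s))
        (Stab.norm_shift_le (slot_injective s')) hx hlim
  · rintro ⟨x, hx⟩
    refine CuntzLE.of_tendsto (fun n => ∑ s : Fin m, Stab.shift A (slot s) n * x n s) ?_
    have hlim : ∀ s s' : Fin m, Tendsto (fun n => Stab.shift A (slot s) n *
        (x n s * b.1 * star (x n s')) * star (Stab.shift A (slot s') n)) atTop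
        (𝓝 (if s = s' then Stab.relabel (slot s) (a s).1 else 0)) := by
      refine fun s s' => tendsto_mul_mul_of_norm_le_one (Stab.norm_shift_le (slot_injective s))
        (Stab.norm_star_shift_le (slot_injective s')) (hx s s') ?_
      split_ifs with h
      · subst h
        exact Stab.tendsto_relabel (slot_injective s) (a s).1
      · simp only [mul_zero, zero_mul, tendsto_const_nhds]
    have hdouble := tendsto_finsetSum Finset.univ fun s _ =>
      tendsto_finsetSum Finset.univ fun s' _ => hlim s s'
    simp only [Finset.sum_ite_eq, Finset.mem_univ, if_true] at hdouble
    refine hdouble.congr fun n => ?_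
    simp only [star_sum, Finset.sum_mul, Finset.mul_sum, star_mul, mul_assoc]
    exact Finset.sum_comm

theorem exists_norm_sum_conj_sub_lt {a : Fin m → PosElt A} {b : PosElt A}
    (h : Cu.mk b ≤ ∑ s, Cu.mk (a s)) {ε : ℝ} (hε : 0 < ε) :
    ∃ d : Fin m → Stab A, ‖∑ s, d s * (a s).1 * star (d s) - b.1‖ < ε := by
  obtain ⟨c, hc, hsum⟩ := exists_mk_eq_sum_mk a
  rw [← hsum, Cu.mk_le_mk, hc] at h
  obtain ⟨x, hx⟩ := h ε hε
  have hlim := (((tendsto_finsetSum Finset.univ fun (s : Fin m) _ =>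
    Stab.tendsto_relabel (slot_injective s) (a s).1).const_mul x).mul_const (star x)).sub_const b.1
  obtain ⟨n, hn⟩ := (hlim.norm.eventually (gt_mem_nhds hx)).exists
  refine ⟨fun s => x * Stab.shift A (slot s) n, lt_of_eq_of_lt ?_ hn⟩
  simp only [Finset.mul_sum, Finset.sum_mul, star_mul, mul_assoc]

theorem mk_le_sum_mk_of_eq_sum_conj {a : Fin m → PosElt A} {b : PosElt A} {d : Fin m → Stab A}
    (h : b.1 = ∑ s, d s * (a s).1 * star (d s)) : Cu.mk b ≤ ∑ s, Cu.mk (a s) := by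
  obtain ⟨c, hc, hsum⟩ := exists_mk_eq_sum_mk a
  rw [← hsum, Cu.mk_le_mk, hc, h]
  refine CuntzLE.of_tendsto (fun n => ∑ s : Fin m, d s * star (Stab.shift A (slot s) n)) ?_
  refine (tendsto_finsetSum Finset.univ fun s _ =>
    ((Stab.tendsto_conj_proj (a s).1).const_mul (d s)).mul_const (star (d s))).congr fun n => ?_
  have hterm : ∀ s s' : Fin m, d s * star (Stab.shift A (slot s) n) *
      (∑ k : Fin m, Stab.relabel (slot k) (a k).1) * star (d s' * star (Stab.shift A (slot s') n)) =
      if s = s' then d s * (Stab.shift A id n * (a s).1 * Stab.shift A id n) * star (d s')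
        else 0 := by
    intro s s'
    have hmid := Stab.star_shift_mul_sum_relabel_mul_shift (fun k => (a k).1) n s s'
    calc _ = d s * (star (Stab.shift A (slot s) n) * (∑ k : Fin m, Stab.relabel (slot k) (a k).1) *
          Stab.shift A (slot s') n) * star (d s') := by simp only [star_mul, star_star, mul_assoc]
      _ = _ := by rw [hmid, mul_ite, ite_mul, mul_zero, zero_mul]
  rw [star_sum, Finset.sum_mul, Finset.sum_mul_sum]
  simp only [hterm, Finset.sum_ite_eq, Finset.mem_univ, if_true]

end Sums

section Normalization

theorem exists_continuous_mul_self_mul_eq_one {r : ℝ} (hr : 0 < r) :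
    ∃ κ : ℝ → ℝ, Continuous κ ∧ κ 0 = 0 ∧ (∀ t, 0 ≤ t → κ t * t * κ t ∈ Set.Icc 0 1) ∧
      ∀ t, r ≤ t → κ t * t * κ t = 1 := by
  have hmax : ∀ t, 0 < max t r := fun t => lt_max_of_lt_right hr
  have hsq : ∀ t, 0 ≤ t → √t / max t r * t * (√t / max t r) = (t / max t r) ^ 2 := fun t ht => by
    rw [div_mul_eq_mul_div, div_mul_div_comm, mul_right_comm, Real.mul_self_sqrt ht, div_pow, sq,
      sq]
  refine ⟨fun t => √t / max t r, Continuous.div (by fun_prop) (by fun_prop) fun t => (hmax t).ne',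
    by simp, fun t ht => ?_, fun t ht => ?_⟩
  · have hle : t / max t r ≤ 1 := (div_le_one (hmax t)).2 (le_max_left _ _)
    simp only [hsq t ht]
    exact ⟨sq_nonneg _, pow_le_one₀ (div_nonneg ht (hmax t).le) hle⟩
  · have ht₀ : 0 < t := hr.trans_le ht
    simp only [hsq t ht₀.le]
    rw [max_eq_left ht, div_self ht₀.ne', one_pow]

attribute [local instance] CStarAlgebra.spectralOrder CStarAlgebra.spectralOrderedRing

variable {B : Type u} [NonUnitalCStarAlgebra B]

theorem norm_sq_le_norm_sum_mul_star {ι : Type*} [Fintype ι] (w : ι → B) (t : ι) :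
    ‖w t‖ ^ 2 ≤ ‖∑ t, w t * star (w t)‖ := by
  rw [sq, ← CStarRing.norm_self_mul_star]
  exact CStarAlgebra.norm_le_norm_of_nonneg_of_le (mul_star_self_nonneg (w t))
    (Finset.single_le_sum (f := fun t => w t * star (w t))
      (fun t _ => mul_star_self_nonneg (w t)) (Finset.mem_univ t))

theorem norm_sub_sqrt_mul_cfcₙ_mul_sqrt_le {a : B} (ha : 0 ≤ a) {f : ℝ → ℝ} (hf : Continuous f)
    (hf₀ : f 0 = 0) {r : ℝ} (h : ∀ t, 0 ≤ t → |t * (1 - f t)| ≤ r) :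
    ‖a - CFC.sqrt a * cfcₙ f a * CFC.sqrt a‖ ≤ r := by
  have hdiff : a - CFC.sqrt a * cfcₙ f a * CFC.sqrt a = cfcₙ (fun t => t - √t * f t * √t) a := by
    nth_rewrite 1 [← cfcₙ_id' ℝ a]
    rw [CFC.sqrt_eq_real_sqrt a ha, ← cfcₙ_mul (√·) f a, ← cfcₙ_mul (fun t => √t * f t) (√·) a,
      ← cfcₙ_sub (fun t => t) _ a]
  rw [hdiff]
  refine norm_cfcₙ_le fun t ht => ?_
  have ht₀ : 0 ≤ t := quasispectrum_nonneg_of_nonneg a ha t ht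
  rw [Real.norm_eq_abs, mul_right_comm, Real.mul_self_sqrt ht₀, ← mul_one_sub]
  exact h t ht₀

theorem exists_norm_sub_sqrt_mul_cube_mul_sqrt_le {a : B} (ha : 0 ≤ a) {r : ℝ} (hr : 0 < r) :
    ∃ k : B, IsSelfAdjoint k ∧ ‖k * a * k‖ ≤ 1 ∧
      ‖a - CFC.sqrt a * (k * a * k * (k * a * k) * (k * a * k)) * CFC.sqrt a‖ ≤ r := by
  obtain ⟨κ, hκ, hκ₀, hmem, hone⟩ := exists_continuous_mul_self_mul_eq_one hr
  let f : ℝ → ℝ := fun t => κ t * t * κ t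
  have hf : Continuous f := by fun_prop
  have hf₀ : f 0 = 0 := by simp [f]
  have he : cfcₙ κ a * a * cfcₙ κ a = cfcₙ f a := by
    nth_rewrite 2 [← cfcₙ_id' ℝ a]
    rw [← cfcₙ_mul κ (fun t => t) a, ← cfcₙ_mul (fun t => κ t * t) κ a]
  refine ⟨cfcₙ κ a, cfcₙ_predicate _ _, ?_, ?_⟩
  · rw [he]
    refine norm_cfcₙ_le fun t ht => ?_
    obtain ⟨h₀, h₁⟩ := hmem t (quasispectrum_nonneg_of_nonneg a ha t ht)
    rwa [Real.norm_of_nonneg h₀]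
  · rw [he, ← cfcₙ_mul f f a, ← cfcₙ_mul (fun t => f t * f t) f a]
    refine norm_sub_sqrt_mul_cfcₙ_mul_sqrt_le ha (by fun_prop) (by simp [hf₀]) fun t ht => ?_
    obtain ⟨h₀, h₁⟩ : f t ∈ Set.Icc 0 1 := hmem t ht
    have hcube : f t * f t * f t ∈ Set.Icc 0 1 :=
      ⟨by positivity, mul_le_one₀ (mul_le_one₀ h₁ h₀ h₁) h₀ h₁⟩
    rw [abs_of_nonneg (mul_nonneg ht (sub_nonneg.2 hcube.2))]
    rcases le_total r t with hrt | hrt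
    · rw [show f t = 1 from hone t hrt]
      simpa using hr.le
    · exact (mul_le_of_le_one_right ht (sub_le_self 1 hcube.1)).trans hrt

variable {A : Type u} [CStarAlgebra A]

theorem PosElt.nonneg (a : PosElt A) : 0 ≤ a.1 :=
  CStarAlgebra.nonneg_iff_eq_star_mul_self.2 a.pos

theorem PosElt.exists_tendsto_mul_cube_mul (a : PosElt A) :
    ∃ (s : Stab A) (b : ℕ → PosElt A), s * star s = a.1 ∧ (∀ k, b k ≤ a ∧ ‖(b k).1‖ ≤ 1) ∧
      Tendsto (fun k => s * ((b k).1 * (b k).1 * (b k).1) * star s) atTop (𝓝 a.1) := by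
  choose k hk hnorm hcut using fun n : ℕ =>
    exists_norm_sub_sqrt_mul_cube_mul_sqrt_le a.nonneg (Nat.one_div_pos_of_nat (α := ℝ) (n := n))
  have hs : star (CFC.sqrt a.1) = CFC.sqrt a.1 := (CFC.sqrt_nonneg a.1).isSelfAdjoint.star_eq
  refine ⟨CFC.sqrt a.1, fun n => ⟨k n * a.1 * k n, ?_⟩, ?_, fun n => ⟨?_, hnorm n⟩, ?_⟩
  · exact CStarAlgebra.nonneg_iff_eq_star_mul_self.1 ((hk n).conjugate_nonneg a.nonneg)
  · rw [hs, CFC.sqrt_mul_sqrt_self a.1 a.nonneg]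
  · have hle := CuntzLE.conj (k n) a.1
    rwa [(hk n).star_eq] at hle
  · rw [hs, tendsto_iff_norm_sub_tendsto_zero]
    refine squeeze_zero (fun _ => norm_nonneg _) (fun n => ?_)
      (tendsto_one_div_add_atTop_nhds_zero_nat (𝕜 := ℝ))
    rw [norm_sub_rev]
    exact hcut n

theorem exists_normalized_conj {ι κ : Type*} {n : ℕ} [Finite κ] (a : ι → PosElt A)
    (ψ : κ → Fin n → ι) (h : ∀ q, unitClass A ≤ ∑ t, Cu.mk (a (ψ q t))) {ε : ℝ} (hε : 0 < ε)
    (hε₁ : ε ≤ 1) :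
    ∃ (b : ι → PosElt A) (w : κ → Fin n → Stab A), (∀ j, b j ≤ a j ∧ ‖(b j).1‖ ≤ 1) ∧
      (∀ q t, ‖w q t‖ ^ 2 ≤ 2) ∧
      ∀ q, ‖∑ t, w q t * ((b (ψ q t)).1 * (b (ψ q t)).1 * (b (ψ q t)).1) * star (w q t) -
        corner A 1‖ < ε := by
  choose d hd using fun q => exists_norm_sum_conj_sub_lt (h q) hε
  choose s b hs hb hlim using fun j => (a j).exists_tendsto_mul_cube_mul
  have hev : ∀ᶠ k in atTop, ∀ q, ‖∑ t, d q t * s (ψ q t) * ((b (ψ q t) k).1 * (b (ψ q t) k).1 *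
      (b (ψ q t) k).1) * star (d q t * s (ψ q t)) - corner A 1‖ < ε := by
    refine eventually_all.2 fun q => Tendsto.eventually_lt_const (hd q) ?_
    refine (Tendsto.sub_const (tendsto_finsetSum _ fun t _ => ?_) _).norm
    simpa only [star_mul, mul_assoc] using
      ((hlim (ψ q t)).const_mul (d q t)).mul_const (star (d q t))
  obtain ⟨k, hk⟩ := hev.exists
  refine ⟨fun j => b j k, fun q t => d q t * s (ψ q t), fun j => hb j k, fun q t => ?_, hk⟩
  have hsum : ∑ t, d q t * s (ψ q t) * star (d q t * s (ψ q t)) =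
      ∑ t, d q t * (a (ψ q t)).1 * star (d q t) :=
    Finset.sum_congr rfl fun t _ => by rw [← hs, star_mul]; simp only [mul_assoc]
  calc ‖d q t * s (ψ q t)‖ ^ 2 ≤ ‖∑ t, d q t * (a (ψ q t)).1 * star (d q t)‖ :=
        hsum ▸ norm_sq_le_norm_sum_mul_star (fun t => d q t * s (ψ q t)) t
    _ ≤ ‖corner A 1‖ + ‖∑ t, d q t * (a (ψ q t)).1 * star (d q t) - corner A 1‖ :=
        norm_le_norm_add_norm_sub' _ _
    _ ≤ 1 + 1 := add_le_add ((norm_corner 1).trans_le (norm_one_le A)) ((hd q).le.trans hε₁)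
    _ = 2 := one_add_one_eq_two

end Normalization

section Solvability

/-- The entries `h s (h s')⋆ - δ_{s s'} c s (c s)⋆`. If they vanish, then the `h s` witness that the
classes of the `c s (c s)⋆` add up to at most `⟨1⟩`. -/
def rowDefect {B : Type*} [NonUnitalRing B] [StarRing B] {m : ℕ} (h c : Fin m → B)
    (s s' : Fin m) : B :=
  h s * star (h s') - if s = s' then c s * star (c s) else 0

/-- The difference `∑ₜ w t (c t (c t)⋆) (w t)⋆ - 1`. If it vanishes, then the `w t` witness that the
classes of the `c t (c t)⋆` add up to at least `⟨1⟩`. -/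
def sumDefect {B : Type*} [Ring B] [StarRing B] {n : ℕ} (w c : Fin n → B) : B :=
  ∑ t, w t * (c t * star (c t)) * star (w t) - 1

variable {J P Q : Type*} {m n : ℕ}

/-- The finite system of inequalities `∑ₛ x (φ p s) ≤ ⟨1⟩` and `⟨1⟩ ≤ ∑ₜ x (ψ q t)` has a solution
`x` in `Cu(A)`. The three divisibility properties of `⟨1⟩` are instances. -/
def Solvable (A : Type u) [CStarAlgebra A] (φ : P → Fin m → J) (ψ : Q → Fin n → J) : Prop :=
  ∃ x : J → Cu A, (∀ p, ∑ s, x (φ p s) ≤ unitClass A) ∧ ∀ q, unitClass A ≤ ∑ t, x (ψ q t)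

/-- Elements of `A` of norm at most `K` that witness, up to the error `ε`, that the classes of the
`c j (c j)⋆` solve the system of inequalities of `Solvable`. -/
structure IsApproxSolution {A : Type u} [CStarAlgebra A] (φ : P → Fin m → J) (ψ : Q → Fin n → J)
    (ε K : ℝ) (c : J → A) (h : P → Fin m → A) (w : Q → Fin n → A) : Prop where
  norm_le : ∀ j, ‖c j‖ ≤ K
  norm_row_le : ∀ p s, ‖h p s‖ ≤ K
  norm_weight_le : ∀ q t, ‖w q t‖ ≤ K
  norm_rowDefect_le : ∀ p s s', ‖rowDefect (h p) (fun s => c (φ p s)) s s'‖ ≤ ε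
  norm_sumDefect_le : ∀ q, ‖sumDefect (w q) (fun t => c (ψ q t))‖ ≤ ε

/-- The system of inequalities of `Solvable` has an approximate solution in `A`, in the sense of
`IsApproxSolution`. -/
def ApproxSolvable (A : Type u) [CStarAlgebra A] (φ : P → Fin m → J) (ψ : Q → Fin n → J)
    (ε K : ℝ) : Prop :=
  ∃ c h w, IsApproxSolution (A := A) φ ψ ε K c h w

variable {A : Type u} [CStarAlgebra A]

instance : IsOrderedAddMonoid (Cu A) where
  add_le_add_left x y hxy z := by
    induction x using Cu.ind with | _ a
    induction y using Cu.ind with | _ b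
    induction z using Cu.ind with | _ c
    exact PosElt.oplus_le_oplus hxy le_rfl

theorem corner_compress_star_mul {y v : Stab A} (hy : y * corner A 1 = y)
    (hv : v * corner A 1 = v) : corner A (compress (star y * v)) = star y * v := by
  have hy' : corner A 1 * star y = star y := by
    simpa only [star_mul, ← map_star, star_one] using congrArg star hy
  rw [corner_compress, ← mul_assoc, hy', mul_assoc, hv]

theorem norm_corner_one_mul_mul_corner_one_le (z : Stab A) :
    ‖corner A 1 * z * corner A 1‖ ≤ ‖z‖ := by
  have hone : ‖corner A 1‖ ≤ 1 := (norm_corner 1).trans_le (norm_one_le A)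
  calc _ ≤ ‖corner A 1‖ * ‖z‖ * ‖corner A 1‖ := norm_mul₃_le
    _ ≤ 1 * ‖z‖ * 1 := by gcongr
    _ = ‖z‖ := by rw [one_mul, mul_one]

theorem corner_rowDefect_compress {y v : Fin m → Stab A} (hy : ∀ s, y s * corner A 1 = y s)
    (hv : ∀ s, v s * corner A 1 = v s) (s s' : Fin m) :
    corner A (rowDefect (fun s => compress (star (y s) * v s))
      (fun s => compress (star (y s) * y s)) s s') = star (y s) * rowDefect v y s s' * y s' := by
  simp only [rowDefect, map_sub, map_mul, map_star, apply_ite (corner A), map_zero,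
    corner_compress_star_mul (hy _) (hv _), corner_compress_star_mul (hy _) (hy _), star_mul,
    star_star, mul_sub, sub_mul, mul_assoc]
  congr 1
  split_ifs with h
  · subst h
    simp only [mul_assoc]
  · rw [zero_mul, mul_zero]

theorem corner_sumDefect_compress {y : Fin n → Stab A} (hy : ∀ t, y t * corner A 1 = y t)
    (w : Fin n → Stab A) :
    corner A (sumDefect (fun t => compress (w t * y t)) fun t => compress (star (y t) * y t)) =
      corner A 1 * (∑ t, w t * (y t * star (y t) * (y t * star (y t)) * (y t * star (y t))) *
        star (w t) - corner A 1) * corner A 1 := by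
  have hw : ∀ t, corner A (compress (w t * y t)) = corner A 1 * w t * y t := fun t => by
    rw [corner_compress, mul_assoc, mul_assoc (w t), hy, mul_assoc]
  have hone : star (corner A 1) = corner A 1 := by rw [← map_star, star_one]
  have hmul : corner A 1 * corner A 1 = corner A 1 := by rw [← map_mul, mul_one]
  simp only [sumDefect, map_sub, map_sum, map_mul, map_star, hw,
    corner_compress_star_mul (hy _) (hy _), star_mul, star_star, hone, mul_sub, sub_mul,
    Finset.mul_sum, Finset.sum_mul, hmul, mul_assoc]

/- For `c = y⋆ y` one has `(w y) (c c⋆) (w y)⋆ = w (y y⋆)³ w⋆`: the cube lets a relation in `A ⊗ 𝒦`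
descend to the corner `A`. -/
theorem isApproxSolution_compress {φ : P → Fin m → J} {ψ : Q → Fin n → J} {ε : ℝ}
    {y : J → Stab A} {v : P → Fin m → Stab A} {w : Q → Fin n → Stab A}
    (hy : ∀ j, y j * corner A 1 = y j) (hv : ∀ p s, v p s * corner A 1 = v p s)
    (hy₂ : ∀ j, ‖y j‖ ^ 2 ≤ 2) (hv₂ : ∀ p s, ‖v p s‖ ^ 2 ≤ 2) (hw₂ : ∀ q t, ‖w q t‖ ^ 2 ≤ 2)
    (hrow : ∀ p s s', ‖rowDefect (v p) (fun s => y (φ p s)) s s'‖ ≤ ε / 2)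
    (hsum : ∀ q, ‖∑ t, w q t * (y (ψ q t) * star (y (ψ q t)) * (y (ψ q t) * star (y (ψ q t))) *
      (y (ψ q t) * star (y (ψ q t)))) * star (w q t) - corner A 1‖ ≤ ε) :
    IsApproxSolution φ ψ ε 2 (fun j => compress (star (y j) * y j))
      (fun p s => compress (star (y (φ p s)) * v p s))
      (fun q t => compress (w q t * y (ψ q t))) := by
  have hmul : ∀ {x z : Stab A}, ‖x‖ ^ 2 ≤ 2 → ‖z‖ ^ 2 ≤ 2 → ‖x‖ * ‖z‖ ≤ 2 := fun {x z} hx hz => by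
    linarith [two_mul_le_add_sq ‖x‖ ‖z‖]
  refine ⟨fun j => ?_, fun p s => ?_, fun q t => ?_, fun p s s' => ?_, fun q => ?_⟩
  · rw [← norm_corner, corner_compress_star_mul (hy j) (hy j)]
    exact (norm_mul_le _ _).trans ((norm_star (y j)).symm ▸ hmul (hy₂ j) (hy₂ j))
  · rw [← norm_corner, corner_compress_star_mul (hy _) (hv p s)]
    exact (norm_mul_le _ _).trans ((norm_star (y _)).symm ▸ hmul (hy₂ _) (hv₂ p s))
  · rw [← norm_corner, corner_compress]
    exact (norm_corner_one_mul_mul_corner_one_le _).trans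
      ((norm_mul_le _ _).trans (hmul (hw₂ q t) (hy₂ _)))
  · rw [← norm_corner, corner_rowDefect_compress (fun s => hy (φ p s)) (hv p)]
    refine norm_mul₃_le.trans ?_
    rw [norm_star, mul_right_comm]
    calc _ ≤ 2 * (ε / 2) :=
          mul_le_mul (hmul (hy₂ _) (hy₂ _)) (hrow p s s') (norm_nonneg _) zero_le_two
      _ = ε := by ring
  · rw [← norm_corner, corner_sumDefect_compress fun t => hy (ψ q t)]
    exact (norm_corner_one_mul_mul_corner_one_le _).trans (hsum q)

theorem exists_rows_of_sum_le_unitClass {b : J → PosElt A} {φ : P → Fin m → J}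
    (hφ : Function.Surjective (Function.uncurry φ))
    (h : ∀ p, ∑ s, Cu.mk (b (φ p s)) ≤ unitClass A) :
    ∃ (y : ℕ → J → Stab A) (v : ℕ → P → Fin m → Stab A),
      (∀ k j, y k j * corner A 1 = y k j) ∧ (∀ k p s, v k p s * corner A 1 = v k p s) ∧
      (∀ j, Tendsto (fun k => y k j * star (y k j)) atTop (𝓝 (b j).1)) ∧
      ∀ p s s', Tendsto (fun k => v k p s * star (v k p s')) atTop
        (𝓝 (if s = s' then (b (φ p s)).1 else 0)) := by
  choose z hz using fun p => (sum_mk_le_mk_iff (fun s => b (φ p s)) _).1 (h p)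
  choose pre hpre using hφ
  have hone : corner A 1 * corner A 1 = corner A 1 := by rw [← map_mul, mul_one]
  have hstar : star (corner A 1) = corner A 1 := by rw [← map_star, star_one]
  let v : ℕ → P → Fin m → Stab A := fun k p s => z p k s * corner A 1
  have hv : ∀ k p s, v k p s * corner A 1 = v k p s := fun k p s => by
    simp only [v, mul_assoc, hone]
  have hlim : ∀ p s s', Tendsto (fun k => v k p s * star (v k p s')) atTop
      (𝓝 (if s = s' then (b (φ p s)).1 else 0)) := fun p s s' => by
    refine (hz p s s').congr fun k => ?_
    change z p k s * corner A 1 * star (z p k s') = _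
    simp only [v, star_mul, hstar, ← mul_assoc, mul_assoc _ (corner A 1) (corner A 1), hone]
  refine ⟨fun k j => v k (pre j).1 (pre j).2, v, fun k j => hv _ _ _, hv, fun j => ?_, hlim⟩
  have hj : φ (pre j).1 (pre j).2 = j := hpre j
  simpa only [if_pos, hj] using hlim (pre j).1 (pre j).2 (pre j).2

theorem Solvable.approxSolvable [Finite P] [Finite Q] {φ : P → Fin m → J} {ψ : Q → Fin n → J}
    (hφ : Function.Surjective (Function.uncurry φ)) (h : Solvable A φ ψ) {ε : ℝ} (hε : 0 < ε)
    (hε₁ : ε ≤ 1) : ApproxSolvable A φ ψ ε 2 := by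
  obtain ⟨x, hrow, hsum⟩ := h
  choose a ha using fun j => Cu.mk_surjective (x j)
  simp only [← ha] at hrow hsum
  obtain ⟨b, w, hb, hw, hwb⟩ := exists_normalized_conj a ψ hsum hε hε₁
  obtain ⟨y, v, hy, hv, hyb, hvb⟩ := exists_rows_of_sum_le_unitClass hφ
    fun p => (Finset.sum_le_sum fun s _ => Cu.mk_le_mk.2 (hb (φ p s)).1).trans (hrow p)
  have : Finite J := .of_surjective _ hφ
  have hnorm : ∀ {u : ℕ → Stab A} (j : J), Tendsto (fun k => u k * star (u k)) atTop
      (𝓝 (b j).1) → ∀ᶠ k in atTop, ‖u k‖ ^ 2 ≤ 2 := fun j hu => by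
    filter_upwards [hu.norm.eventually_le_const ((hb j).2.trans_lt one_lt_two)] with k hk
    rwa [sq, ← CStarRing.norm_self_mul_star]
  have hy₂ : ∀ᶠ k in atTop, ∀ j, ‖y k j‖ ^ 2 ≤ 2 := eventually_all.2 fun j => hnorm j (hyb j)
  have hv₂ : ∀ᶠ k in atTop, ∀ p s, ‖v k p s‖ ^ 2 ≤ 2 :=
    eventually_all.2 fun p => eventually_all.2 fun s =>
      hnorm (φ p s) (by simpa only [if_pos] using hvb p s s)
  have hdefect : ∀ᶠ k in atTop, ∀ p s s',
      ‖rowDefect (v k p) (fun s => y k (φ p s)) s s'‖ ≤ ε / 2 := by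
    refine eventually_all.2 fun p => eventually_all.2 fun s => eventually_all.2 fun s' =>
      Tendsto.eventually_le_const (half_pos hε) (tendsto_zero_iff_norm_tendsto_zero.1 ?_)
    rw [← sub_self (if s = s' then (b (φ p s)).1 else 0)]
    refine (hvb p s s').sub ?_
    split_ifs
    exacts [hyb _, tendsto_const_nhds]
  have hsum' : ∀ᶠ k in atTop, ∀ q, ‖∑ t, w q t * (y k (ψ q t) * star (y k (ψ q t)) *
      (y k (ψ q t) * star (y k (ψ q t))) * (y k (ψ q t) * star (y k (ψ q t)))) * star (w q t) -
      corner A 1‖ ≤ ε := by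
    refine eventually_all.2 fun q => Tendsto.eventually_le_const (hwb q) ?_
    exact ((tendsto_finsetSum _ fun t _ => ((((hyb _).mul (hyb _)).mul (hyb _)).const_mul
      (w q t)).mul_const (star (w q t))).sub_const _).norm
  obtain ⟨k, hyk, hvk, hdk, hsk⟩ := (hy₂.and (hv₂.and (hdefect.and hsum'))).exists
  exact ⟨_, _, _, isApproxSolution_compress (hy k) (hv k) hyk hvk hw hdk hsk⟩

end Solvability

section Stability

attribute [local instance] CStarAlgebra.spectralOrder CStarAlgebra.spectralOrderedRing

variable {A : Type u} [CStarAlgebra A] {m n : ℕ}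

/-- The inclusion `M_m(A) → A ⊗ 𝒦` as the upper left corner. -/
noncomputable def ofMatrix : Matrix (Fin m) (Fin m) A →⋆ₙₐ[ℂ] Stab A where
  toFun M := ∑ s, ∑ s', Stab.single s.1 s'.1 (M s s')
  map_smul' c M := by
    simp only [Matrix.smul_apply, Stab.single_smul, Finset.smul_sum, MonoidHom.id_apply]
  map_zero' := by simp only [Matrix.zero_apply, Stab.single_zero, Finset.sum_const_zero]
  map_add' M N := by simp only [Matrix.add_apply, Stab.single_add, Finset.sum_add_distrib]
  map_mul' M N := by
    have hsum : ∀ (i j : ℕ) (f : Fin m → A),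
        Stab.single i j (∑ r, f r) = ∑ r, Stab.single i j (f r) := fun i j f =>
      map_sum (AddMonoidHom.mk' (Stab.single i j) (Stab.single_add i j)) f Finset.univ
    have hrow : ∀ (i : ℕ) (r : Fin m) (a : A),
        Stab.single i r.1 a * ∑ r', ∑ s', Stab.single r'.1 s'.1 (N r' s') =
          ∑ s' : Fin m, Stab.single i s'.1 (a * N r s') := fun i r a => by
      simp only [Finset.mul_sum, Stab.single_mul_single, Fin.val_inj]
      rw [Finset.sum_comm]
      simp only [Finset.sum_ite_eq, Finset.mem_univ, if_true]
    simp only [Matrix.mul_apply, hsum, Finset.sum_mul, hrow]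
    exact Finset.sum_congr rfl fun s _ => Finset.sum_comm
  map_star' M := by
    simp only [star_sum, Stab.star_single, Matrix.star_apply]
    exact Finset.sum_comm

theorem norm_ofMatrix_le (M : Matrix (Fin m) (Fin m) A) :
    ‖ofMatrix M‖ ≤ ∑ s, ∑ s', ‖M s s'‖ :=
  norm_sum_le_of_le _ fun _ _ => norm_sum_le_of_le _ fun _ _ => Stab.norm_single_le _ _ _

theorem single_mul_ofMatrix_mul_single (M : Matrix (Fin m) (Fin m) A) (s s' : Fin m) :
    Stab.single 0 s.1 1 * ofMatrix M * Stab.single s'.1 0 1 = corner A (M s s') := by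
  change Stab.single 0 s.1 1 * (∑ r : Fin m, ∑ r' : Fin m, Stab.single r.1 r'.1 (M r r')) *
    Stab.single s'.1 0 1 = Stab.single 0 0 (M s s')
  have hleft : ∀ r r' : Fin m, Stab.single 0 s.1 1 * Stab.single r.1 r'.1 (M r r') *
      Stab.single s'.1 0 1 = if r' = s' then if s = r then Stab.single 0 0 (M r r') else 0 else 0 :=
    fun r r' => by
      simp only [Stab.single_mul_single, Fin.val_inj, ite_mul, zero_mul, one_mul, mul_one]
      split_ifs <;> rfl
  simp only [Finset.mul_sum, Finset.sum_mul, hleft, Finset.sum_ite_eq', Finset.sum_ite_eq,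
    Finset.mem_univ, if_true]

theorem sum_single_mul_single_mul_star (h : Fin m → A) :
    (∑ s : Fin m, Stab.single s.1 0 (h s)) * Stab.single 0 0 1 *
      star (∑ s : Fin m, Stab.single s.1 0 (h s)) = ofMatrix (Matrix.vecMulVec h (star h)) := by
  rw [star_sum, Finset.sum_mul, Finset.sum_mul_sum]
  simp only [Stab.star_single, Stab.single_mul_single, if_true, mul_one]
  rfl

theorem ofMatrix_diagonal_nonneg {d : Fin m → A} (hd : ∀ s, 0 ≤ d s) :
    0 ≤ ofMatrix (Matrix.diagonal d) := by
  choose b hb using fun s => CStarAlgebra.nonneg_iff_eq_star_mul_self.1 (hd s)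
  have hdb : Matrix.diagonal d = star (Matrix.diagonal b) * Matrix.diagonal b := by
    rw [Matrix.star_eq_conjTranspose, Matrix.diagonal_conjTranspose, Matrix.diagonal_mul_diagonal]
    exact congrArg Matrix.diagonal (funext hb)
  rw [hdb, map_mul, map_star]
  exact star_mul_self_nonneg _

theorem exists_continuous_cutoff {κ : ℝ} (hκ : 0 < κ) :
    ∃ γ : ℝ → ℝ, Continuous γ ∧ ∀ t, 0 ≤ t → 0 ≤ γ t * t * γ t - κ • (γ t * γ t) ∧
      |γ t * t * γ t - κ • (γ t * γ t) - t| ≤ 3 * κ := by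
  let γ : ℝ → ℝ := fun t => 1 - κ / max t κ
  have hmax : ∀ t, max t κ ≠ 0 := fun t => (lt_max_of_lt_right hκ).ne'
  refine ⟨γ, by fun_prop (disch := exact hmax _), fun t ht => ?_⟩
  rcases le_total t κ with h | h
  · have hzero : γ t = 0 := by simp only [γ, max_eq_right h, div_self hκ.ne', sub_self]
    simp only [hzero, zero_mul, mul_zero, smul_zero, sub_zero, zero_sub, abs_neg,
      abs_of_nonneg ht]
    exact ⟨le_rfl, by linarith⟩
  · have ht₀ : 0 < t := hκ.trans_le h
    have hγ₀ : 0 ≤ γ t := by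
      simpa only [γ, max_eq_left h, sub_nonneg] using (div_le_one ht₀).2 h
    have hγ₁ : γ t ≤ 1 := sub_le_self 1 (by positivity)
    have hκt : κ = t * (1 - γ t) := by
      simp only [γ, max_eq_left h, sub_sub_cancel, mul_div_cancel₀ _ ht₀.ne']
    have hcube : γ t * t * γ t - κ • (γ t * γ t) = t * γ t ^ 3 := by
      conv_lhs => rw [hκt]
      rw [smul_eq_mul]
      ring
    have hbernoulli : 1 + 3 * (γ t - 1) ≤ γ t ^ 3 := by
      nlinarith [mul_nonneg (sq_nonneg (γ t - 1)) (by linarith : 0 ≤ γ t + 2)]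
    rw [hcube, ← mul_sub_one, abs_mul, abs_of_pos ht₀,
      abs_of_nonpos (sub_nonpos.2 (pow_le_one₀ hγ₀ hγ₁))]
    exact ⟨by positivity, by rw [hκt]; nlinarith⟩

theorem exists_cutoff {e : A} (he : 0 ≤ e) {κ : ℝ} (hκ : 0 < κ) :
    ∃ g : A, IsSelfAdjoint g ∧ 0 ≤ g * e * g - κ • (g * g) ∧
      ‖g * e * g - κ • (g * g) - e‖ ≤ 3 * κ := by
  obtain ⟨γ, hγ, hvalue⟩ := exists_continuous_cutoff hκ
  have heq : cfc γ e * e * cfc γ e - κ • (cfc γ e * cfc γ e) =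
      cfc (fun t => γ t * t * γ t - κ • (γ t * γ t)) e := by
    rw [cfc_sub (fun t => γ t * t * γ t) (fun t => κ • (γ t * γ t)) e, cfc_smul κ _ e,
      cfc_mul γ γ e, cfc_mul (fun t => γ t * t) γ e, cfc_mul γ (fun t => t) e, cfc_id' ℝ e]
  refine ⟨cfc γ e, cfc_predicate _ _, ?_, ?_⟩
  · rw [heq]
    exact cfc_nonneg fun t ht => (hvalue t (spectrum_nonneg_of_nonneg he ht)).1
  · rw [heq]
    nth_rewrite 2 [← cfc_id' ℝ e]
    rw [← cfc_sub _ (fun t => t) e]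
    exact norm_cfc_le (by positivity) fun t ht => (hvalue t (spectrum_nonneg_of_nonneg he ht)).2

theorem ofMatrix_diagonal_cuntzLE_of_norm_rowDefect_le {h c g : Fin m → A} {κ : ℝ}
    (hdefect : ∑ s, ∑ s', ‖rowDefect h c s s'‖ ≤ κ) (hg : ∀ s, IsSelfAdjoint (g s))
    (hpos : ∀ s, 0 ≤ g s * (c s * star (c s)) * g s - κ • (g s * g s)) :
    CuntzLE (ofMatrix (Matrix.diagonal fun s => g s * (c s * star (c s)) * g s - κ • (g s * g s)))
      (Stab.single 0 0 1) := by
  have hdiff : ofMatrix (Matrix.diagonal fun s => c s * star (c s)) -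
      ofMatrix (Matrix.vecMulVec h (star h)) = -ofMatrix (Matrix.of (rowDefect h c)) := by
    rw [← map_sub, ← map_neg]
    congr 1
    ext s s'
    simp only [rowDefect, Matrix.sub_apply, Matrix.diagonal_apply, Matrix.vecMulVec_apply,
      Matrix.neg_apply, Matrix.of_apply, neg_sub, Pi.star_apply]
  have hstar : star (ofMatrix (Matrix.diagonal g)) = ofMatrix (Matrix.diagonal g) := by
    rw [← map_star, Matrix.star_eq_conjTranspose, Matrix.diagonal_conjTranspose]
    exact congrArg (fun d => ofMatrix (Matrix.diagonal d)) (funext fun s => (hg s).star_eq)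
  have hcut :
      ofMatrix (Matrix.diagonal fun s => g s * (c s * star (c s)) * g s - κ • (g s * g s)) =
      ofMatrix (Matrix.diagonal g) * ofMatrix (Matrix.diagonal fun s => c s * star (c s)) *
        star (ofMatrix (Matrix.diagonal g)) -
      κ • (ofMatrix (Matrix.diagonal g) * star (ofMatrix (Matrix.diagonal g))) := by
    rw [hstar, ← map_mul, ← map_mul, ← map_mul, ← Complex.coe_smul, ← map_smul, ← map_sub,
      Matrix.diagonal_mul_diagonal, Matrix.diagonal_mul_diagonal, Matrix.diagonal_mul_diagonal,
      ← Matrix.diagonal_smul, Matrix.diagonal_sub]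
    rfl
  have hsa : IsSelfAdjoint (ofMatrix (Matrix.diagonal fun s => c s * star (c s)) -
      ofMatrix (Matrix.vecMulVec h (star h))) := by
    rw [← sum_single_mul_single_mul_star]
    exact (ofMatrix_diagonal_nonneg fun s => mul_star_self_nonneg (c s)).isSelfAdjoint.sub
      ((Stab.isStarProjection_single_one A).isSelfAdjoint.conjugate _)
  have hnonneg := ofMatrix_diagonal_nonneg hpos
  rw [hcut] at hnonneg ⊢
  refine (CuntzLE.conj_sub_smul_of_norm_sub_le hsa ?_ _ hnonneg).trans ?_
  · rw [hdiff, norm_neg]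
    exact (norm_ofMatrix_le _).trans hdefect
  · rw [← sum_single_mul_single_mul_star]
    exact CuntzLE.conj _ _

theorem sum_mk_le_of_ofMatrix_diagonal_cuntzLE {k : Fin m → A} {a : Fin m → PosElt A}
    (ha : ∀ s, (a s).1 = corner A (k s)) {b : PosElt A}
    (h : CuntzLE (ofMatrix (Matrix.diagonal k)) b.1) : ∑ s, Cu.mk (a s) ≤ Cu.mk b := by
  obtain ⟨x, hx⟩ := h.exists_tendsto
  refine (sum_mk_le_mk_iff a b).2 ⟨fun N s => Stab.single 0 s.1 1 * x N, fun s s' => ?_⟩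
  have hlim := (hx.const_mul (Stab.single 0 s.1 1)).mul_const (Stab.single s'.1 0 1)
  rw [single_mul_ofMatrix_mul_single, Matrix.diagonal_apply, apply_ite (corner A), map_zero,
    ← ha] at hlim
  simpa only [star_mul, Stab.star_single, star_one, mul_assoc] using hlim

theorem unitClass_le_sum_mk_of_norm_sub_one_lt {k w : Fin n → A} {a : Fin n → PosElt A}
    (ha : ∀ t, (a t).1 = corner A (k t)) (h : ‖∑ t, w t * k t * star (w t) - 1‖ < 1) :
    unitClass A ≤ ∑ t, Cu.mk (a t) := by
  have hconj : corner A (∑ t, w t * k t * star (w t)) =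
      ∑ t, corner A (w t) * (a t).1 * star (corner A (w t)) := by
    simp only [map_sum, map_mul, map_star, ha]
  have hnonneg : 0 ≤ corner A (∑ t, w t * k t * star (w t)) := by
    rw [hconj]
    exact Finset.sum_nonneg fun t _ => star_right_conjugate_nonneg (a t).nonneg _
  let b : PosElt A := ⟨_, CStarAlgebra.nonneg_iff_eq_star_mul_self.1 hnonneg⟩
  have hb : unitClass A ≤ Cu.mk b := by
    refine CuntzLE.of_isStarProjection (Stab.isStarProjection_single_one A)
      hnonneg.isSelfAdjoint ?_
    change ‖corner A 1 - corner A _‖ < 1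
    rwa [← map_sub, norm_corner, norm_sub_rev]
  exact hb.trans (mk_le_sum_mk_of_eq_sum_conj hconj)

variable {J P Q : Type*} {φ : P → Fin m → J} {ψ : Q → Fin n → J}

theorem ApproxSolvable.solvable {ε κ K : ℝ} (h : ApproxSolvable A φ ψ ε K) (hκ : 0 < κ)
    (hεκ : m * (m * ε) ≤ κ) (hlt : n * (K * (3 * κ) * K) + ε < 1) : Solvable A φ ψ := by
  obtain ⟨c, h, w, hsol⟩ := h
  choose g hg hpos hnorm using fun j => exists_cutoff (mul_star_self_nonneg (c j)) hκ
  let k : J → A := fun j => g j * (c j * star (c j)) * g j - κ • (g j * g j)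
  choose b hb using fun j => CStarAlgebra.nonneg_iff_eq_star_mul_self.1 (hpos j)
  let a : J → PosElt A := fun j => ⟨corner A (k j), corner A (b j), by
    rw [← map_star, ← map_mul, ← hb]⟩
  refine ⟨fun j => Cu.mk (a j), fun p => ?_, fun q => ?_⟩
  · refine sum_mk_le_of_ofMatrix_diagonal_cuntzLE (fun _ => rfl)
      (ofMatrix_diagonal_cuntzLE_of_norm_rowDefect_le (h := h p) (c := fun s => c (φ p s)) ?_
        (fun s => hg (φ p s)) fun s => hpos (φ p s))
    calc _ ≤ ∑ _ : Fin m, ∑ _ : Fin m, ε :=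
          Finset.sum_le_sum fun s _ => Finset.sum_le_sum fun s' _ => hsol.norm_rowDefect_le p s s'
      _ ≤ κ := by simpa using hεκ
  · refine unitClass_le_sum_mk_of_norm_sub_one_lt (k := fun t => k (ψ q t)) (w := w q)
      (fun _ => rfl) ?_
    have hterm : ∀ t, ‖w q t * (k (ψ q t) - c (ψ q t) * star (c (ψ q t))) * star (w q t)‖ ≤
        K * (3 * κ) * K := fun t => by
      have hw := hsol.norm_weight_le q t
      refine norm_mul₃_le.trans ?_
      rw [norm_star]
      have := (norm_nonneg _).trans hw
      gcongr
      exact hnorm (ψ q t)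
    have hsplit : ∑ t, w q t * k (ψ q t) * star (w q t) - 1 =
        ∑ t, w q t * (k (ψ q t) - c (ψ q t) * star (c (ψ q t))) * star (w q t) +
          sumDefect (w q) fun t => c (ψ q t) := by
      simp only [sumDefect, mul_sub, sub_mul, Finset.sum_sub_distrib]
      abel
    rw [hsplit]
    calc _ ≤ ∑ _ : Fin n, K * (3 * κ) * K + ε :=
          norm_add_le_of_le (norm_sum_le_of_le _ fun t _ => hterm t) (hsol.norm_sumDefect_le q)
      _ < 1 := by simpa using hlt

theorem exists_forall_solvable_of_approxSolvable (m n : ℕ) (K : ℝ) :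
    ∃ ε : ℝ, 0 < ε ∧ ε ≤ 1 ∧ ∀ {A : Type u} [CStarAlgebra A] {J P Q : Type*} {φ : P → Fin m → J}
      {ψ : Q → Fin n → J}, ApproxSolvable A φ ψ ε K → Solvable A φ ψ := by
  obtain ⟨κ, hκ, hκK⟩ := exists_pos_mul_lt (half_pos one_pos) (n * (K * 3 * K))
  obtain ⟨ε, hε, hεκ⟩ := exists_pos_mul_lt (lt_min hκ (half_pos one_pos)) (m * m + 1)
  rw [lt_min_iff] at hεκ
  have hmε : 0 ≤ m * m * ε := by positivity
  exact ⟨ε, hε, by linarith, fun {A} _ J P Q φ ψ h => h.solvable hκ (by linarith) (by linarith)⟩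

end Stability

section Products

theorem map_rowDefect {B C : Type*} [NonUnitalRing B] [StarRing B] [NonUnitalRing C] [StarRing C]
    {F : Type*} [FunLike F B C] [NonUnitalRingHomClass F B C] [StarHomClass F B C] (f : F) {m : ℕ}
    (h c : Fin m → B) (s s' : Fin m) :
    f (rowDefect h c s s') = rowDefect (fun s => f (h s)) (fun s => f (c s)) s s' := by
  simp only [rowDefect, map_sub, map_mul, map_star, apply_ite f, map_zero]

theorem map_sumDefect {B C : Type*} [Ring B] [StarRing B] [Ring C] [StarRing C]
    {F : Type*} [FunLike F B C] [RingHomClass F B C] [StarHomClass F B C] (f : F) {n : ℕ}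
    (w c : Fin n → B) : f (sumDefect w c) = sumDefect (fun t => f (w t)) fun t => f (c t) := by
  simp only [sumDefect, map_sub, map_sum, map_mul, map_star, map_one]

variable {J P Q : Type*} {m n : ℕ} {φ : P → Fin m → J} {ψ : Q → Fin n → J} {ε ε' K K' : ℝ}

theorem IsApproxSolution.map {B C : Type*} [CStarAlgebra B] [CStarAlgebra C] (f : B →⋆ₐ[ℂ] C)
    {c : J → B} {h : P → Fin m → B} {w : Q → Fin n → B} (hsol : IsApproxSolution φ ψ ε K c h w) :
    IsApproxSolution φ ψ ε K (fun j => f (c j)) (fun p s => f (h p s)) fun q t => f (w q t) where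
  norm_le j := (NonUnitalStarAlgHom.norm_apply_le f _).trans (hsol.norm_le j)
  norm_row_le p s := (NonUnitalStarAlgHom.norm_apply_le f _).trans (hsol.norm_row_le p s)
  norm_weight_le q t := (NonUnitalStarAlgHom.norm_apply_le f _).trans (hsol.norm_weight_le q t)
  norm_rowDefect_le p s s' := map_rowDefect f (h p) _ s s' ▸
    (NonUnitalStarAlgHom.norm_apply_le f _).trans (hsol.norm_rowDefect_le p s s')
  norm_sumDefect_le q := map_sumDefect f (w q) _ ▸
    (NonUnitalStarAlgHom.norm_apply_le f _).trans (hsol.norm_sumDefect_le q)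

variable {A : ℕ → Type u} [∀ k, CStarAlgebra (A k)]

/-- The projection of `∏ A_k` onto its `k`-th factor. -/
noncomputable def BProd.coordHom (k : ℕ) : BProd A →⋆ₐ[ℂ] A k where
  toFun a := a.coord k
  map_one' := rfl
  map_mul' _ _ := rfl
  map_zero' := rfl
  map_add' _ _ := rfl
  commutes' r := by simp only [Algebra.algebraMap_eq_smul_one, coord_smul, coord_one]
  map_star' _ := rfl

/-- The quotient map `∏ A_k → ∏_ω A_k`. -/
noncomputable def RProd.mkHom (ω : Filter ℕ) : BProd A →⋆ₐ[ℂ] RProd A ω where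
  __ := RProd.mk ω
  map_star' _ := rfl

/-- The coordinates `c`, `h`, `w` form an approximate solution of the system in `A_k`. -/
def IsApproxSolutionAt (φ : P → Fin m → J) (ψ : Q → Fin n → J) (ε K : ℝ) (k : ℕ) (c : J → BProd A)
    (h : P → Fin m → BProd A) (w : Q → Fin n → BProd A) : Prop :=
  IsApproxSolution φ ψ ε K (fun j => BProd.coordHom k (c j))
    (fun p s => BProd.coordHom k (h p s)) fun q t => BProd.coordHom k (w q t)

theorem exists_forall_mem_isApproxSolutionAt (hK : 0 ≤ K) {S : Set ℕ}
    (hS : ∀ k ∈ S, ApproxSolvable (A k) φ ψ ε K) :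
    ∃ (c : J → BProd A) (h : P → Fin m → BProd A) (w : Q → Fin n → BProd A),
      ∀ k ∈ S, IsApproxSolutionAt φ ψ ε K k c h w := by
  choose c h w hsol using hS
  have hpatch : ∀ x : ∀ k ∈ S, A k, (∀ k hk, ‖x k hk‖ ≤ K) →
      ∃ y : BProd A, ∀ k hk, BProd.coordHom k y = x k hk := by
    classical
    refine fun x hx => ⟨BProd.mk (fun k => if hk : k ∈ S then x k hk else 0) K fun k => ?_,
      fun k hk => dif_pos hk⟩
    split_ifs with hk
    exacts [hx k hk, norm_zero.trans_le hK]
  choose c' hc using fun j => hpatch (fun k hk => c k hk j) fun k hk => (hsol k hk).norm_le j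
  choose h' hh using fun p s => hpatch (fun k hk => h k hk p s)
    fun k hk => (hsol k hk).norm_row_le p s
  choose w' hw using fun q t => hpatch (fun k hk => w k hk q t)
    fun k hk => (hsol k hk).norm_weight_le q t
  refine ⟨c', h', w', fun k hk => ?_⟩
  simpa only [IsApproxSolutionAt, hc _ k hk, hh _ _ k hk, hw _ _ k hk] using hsol k hk

variable {c : J → BProd A} {h : P → Fin m → BProd A} {w : Q → Fin n → BProd A}

theorem IsApproxSolution.of_coord (hε : 0 ≤ ε) (hK : 0 ≤ K)
    (hsol : ∀ k, IsApproxSolutionAt φ ψ ε K k c h w) : IsApproxSolution φ ψ ε K c h w where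
  norm_le j := BProd.norm_le hK fun k => (hsol k).norm_le j
  norm_row_le p s := BProd.norm_le hK fun k => (hsol k).norm_row_le p s
  norm_weight_le q t := BProd.norm_le hK fun k => (hsol k).norm_weight_le q t
  norm_rowDefect_le p s s' := BProd.norm_le hε fun k =>
    (congrArg norm (map_rowDefect (BProd.coordHom k) (h p) _ s s')).trans_le
      ((hsol k).norm_rowDefect_le p s s')
  norm_sumDefect_le q := BProd.norm_le hε fun k =>
    (congrArg norm (map_sumDefect (BProd.coordHom k) (w q) _)).trans_le
      ((hsol k).norm_sumDefect_le q)

theorem IsApproxSolution.mkHom {ω : Filter ℕ} (hε : 0 ≤ ε) (hK : 0 ≤ K)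
    (hsol : ∀ᶠ k in ω, IsApproxSolutionAt φ ψ ε K k c h w) :
    IsApproxSolution φ ψ ε K (fun j => RProd.mkHom ω (c j)) (fun p s => RProd.mkHom ω (h p s))
      fun q t => RProd.mkHom ω (w q t) where
  norm_le j := RProd.norm_le hK <| hsol.mono fun _ hk => hk.norm_le j
  norm_row_le p s := RProd.norm_le hK <| hsol.mono fun _ hk => hk.norm_row_le p s
  norm_weight_le q t := RProd.norm_le hK <| hsol.mono fun _ hk => hk.norm_weight_le q t
  norm_rowDefect_le p s s' := by
    rw [← map_rowDefect (RProd.mkHom ω) (h p) (fun s => c (φ p s))]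
    refine RProd.norm_le hε <| hsol.mono fun k hk => ?_
    exact (congrArg norm (map_rowDefect (BProd.coordHom k) (h p) _ s s')).trans_le
      (hk.norm_rowDefect_le p s s')
  norm_sumDefect_le q := by
    rw [← map_sumDefect (RProd.mkHom ω) (w q) fun t => c (ψ q t)]
    refine RProd.norm_le hε <| hsol.mono fun k hk => ?_
    exact (congrArg norm (map_sumDefect (BProd.coordHom k) (w q) _)).trans_le
      (hk.norm_sumDefect_le q)

theorem IsApproxSolution.eventually_isApproxSolutionAt [Finite J] [Finite P] [Finite Q]
    {ω : Filter ℕ} (hε : ε < ε') (hK : K < K')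
    (hsol : IsApproxSolution φ ψ ε K (fun j => RProd.mkHom ω (c j))
      (fun p s => RProd.mkHom ω (h p s)) fun q t => RProd.mkHom ω (w q t)) :
    ∀ᶠ k in ω, IsApproxSolutionAt φ ψ ε' K' k c h w := by
  have hcoord : ∀ {x : BProd A} {r r' : ℝ}, ‖RProd.mkHom ω x‖ ≤ r → r < r' →
      ∀ᶠ k in ω, ‖BProd.coordHom k x‖ ≤ r' := fun hx hr =>
    (RProd.eventually_lt (hx.trans_lt hr)).mono fun _ => le_of_lt
  have hc : ∀ᶠ k in ω, ∀ j, ‖BProd.coordHom k (c j)‖ ≤ K' :=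
    eventually_all.2 fun j => hcoord (hsol.norm_le j) hK
  have hh : ∀ᶠ k in ω, ∀ p s, ‖BProd.coordHom k (h p s)‖ ≤ K' :=
    eventually_all.2 fun p => eventually_all.2 fun s => hcoord (hsol.norm_row_le p s) hK
  have hw : ∀ᶠ k in ω, ∀ q t, ‖BProd.coordHom k (w q t)‖ ≤ K' :=
    eventually_all.2 fun q => eventually_all.2 fun t => hcoord (hsol.norm_weight_le q t) hK
  have hrow : ∀ᶠ k in ω, ∀ p s s',
      ‖BProd.coordHom k (rowDefect (h p) (fun s => c (φ p s)) s s')‖ ≤ ε' := by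
    refine eventually_all.2 fun p => eventually_all.2 fun s => eventually_all.2 fun s' =>
      hcoord ?_ hε
    exact (map_rowDefect (RProd.mkHom ω) (h p) _ s s').symm ▸ hsol.norm_rowDefect_le p s s'
  have hsum : ∀ᶠ k in ω, ∀ q,
      ‖BProd.coordHom k (sumDefect (w q) fun t => c (ψ q t))‖ ≤ ε' := by
    refine eventually_all.2 fun q => hcoord ?_ hε
    exact (map_sumDefect (RProd.mkHom ω) (w q) _).symm ▸ hsol.norm_sumDefect_le q
  simp only [map_rowDefect, map_sumDefect] at hrow hsum
  filter_upwards [hc, hh, hw, hrow, hsum] with k hck hhk hwk hrk hsk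
  exact ⟨hck, hhk, hwk, hrk, hsk⟩

variable [Finite P] [Finite Q]

theorem solvable_bprod_iff (A : ℕ → Type u) [∀ k, CStarAlgebra (A k)]
    (hφ : Function.Surjective (Function.uncurry φ)) (ψ : Q → Fin n → J) :
    Solvable (BProd A) φ ψ ↔ ∀ k, Solvable (A k) φ ψ := by
  obtain ⟨ε, hε, hε₁, hstable⟩ := exists_forall_solvable_of_approxSolvable m n 2
  constructor
  · intro h k
    obtain ⟨c, h, w, hsol⟩ := h.approxSolvable hφ hε hε₁
    exact hstable ⟨_, _, _, hsol.map (BProd.coordHom k)⟩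
  · intro h
    obtain ⟨c, h, w, hsol⟩ := exists_forall_mem_isApproxSolutionAt zero_le_two
      fun k (_ : k ∈ Set.univ) => (h k).approxSolvable hφ hε hε₁
    exact hstable ⟨c, h, w, .of_coord hε.le zero_le_two fun k => hsol k trivial⟩

theorem solvable_rprod_iff (A : ℕ → Type u) [∀ k, CStarAlgebra (A k)] (ω : Filter ℕ)
    (hφ : Function.Surjective (Function.uncurry φ)) (ψ : Q → Fin n → J) :
    Solvable (RProd A ω) φ ψ ↔ ∀ᶠ k in ω, Solvable (A k) φ ψ := by
  have : Finite J := .of_surjective _ hφ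
  constructor
  · intro h
    obtain ⟨ε, hε, hε₁, hstable⟩ := exists_forall_solvable_of_approxSolvable m n 3
    obtain ⟨c, h, w, hsol⟩ := h.approxSolvable hφ (half_pos hε) (half_le_self hε.le |>.trans hε₁)
    choose c' hc using fun j => RProd.mk_surjective ω (c j)
    choose h' hh using fun p s => RProd.mk_surjective ω (h p s)
    choose w' hw using fun q t => RProd.mk_surjective ω (w q t)
    obtain rfl : (fun j => RProd.mkHom ω (c' j)) = c := funext hc
    obtain rfl : (fun p s => RProd.mkHom ω (h' p s)) = h := funext₂ hh
    obtain rfl : (fun q t => RProd.mkHom ω (w' q t)) = w := funext₂ hw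
    filter_upwards [hsol.eventually_isApproxSolutionAt (half_lt_self hε)
      (by norm_num : (2 : ℝ) < 3)] with k hk using hstable ⟨_, _, _, hk⟩
  · intro h
    obtain ⟨ε, hε, hε₁, hstable⟩ := exists_forall_solvable_of_approxSolvable m n 2
    obtain ⟨c, h', w, hsol⟩ := exists_forall_mem_isApproxSolutionAt zero_le_two
      fun k (hk : k ∈ {k | Solvable (A k) φ ψ}) => Solvable.approxSolvable hφ hk hε hε₁
    exact hstable ⟨_, _, _, .mkHom hε.le zero_le_two (h.mono hsol)⟩

end Products

section Divisibility

variable {A : Type u} [CStarAlgebra A]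

theorem CompactlyContained.le {S : Type*} [PartialOrder S] [AddCommMonoid S] {u v : S}
    (h : CompactlyContained u v) : u ≤ v :=
  (h (fun _ => v) monotone_const (by simp)).elim fun _ hi => hi

theorem isDivisible_unitClass_iff {m n : ℕ} : IsDivisible m n (unitClass A) ↔
    Solvable A (fun (_ : Unit) (_ : Fin m) => ()) fun (_ : Unit) (_ : Fin n) => () := by
  constructor
  · intro h
    obtain ⟨x, hle, hge⟩ := h _ compactlyContained_unitClass
    exact ⟨fun _ => x, fun _ => by simpa using hle, fun _ => by simpa using hge⟩
  · rintro ⟨x, hle, hge⟩ u' hu'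
    exact ⟨x (), by simpa using hle (), by simpa using hu'.le.trans (hge ())⟩

theorem isDecomposable_unitClass_iff {m n : ℕ} : IsDecomposable m n (unitClass A) ↔
    Solvable A (fun (_ : Unit) (s : Fin m) => s) fun (j : Fin m) (_ : Fin n) => j := by
  constructor
  · intro h
    obtain ⟨x, hle, hge⟩ := h _ compactlyContained_unitClass
    exact ⟨x, fun _ => hle, fun j => by simpa using hge j⟩
  · rintro ⟨x, hle, hge⟩ u' hu'
    exact ⟨x, hle (), fun j => by simpa using hu'.le.trans (hge j)⟩

theorem isWeaklyDivisible_unitClass_iff {m n : ℕ} : IsWeaklyDivisible m n (unitClass A) ↔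
    Solvable A (fun (j : Fin n) (_ : Fin m) => j) fun (_ : Unit) (t : Fin n) => t := by
  constructor
  · intro h
    obtain ⟨x, hle, hge⟩ := h _ compactlyContained_unitClass
    exact ⟨x, fun j => by simpa using hle j, fun _ => hge⟩
  · rintro ⟨x, hle, hge⟩ u' hu'
    exact ⟨x, fun j => by simpa using hle j, hu'.le.trans (hge ())⟩

theorem Cu.zero_le (x : Cu A) : 0 ≤ x := by
  induction x using Cu.ind with | _ a
  exact Cu.mk_le_mk.2 fun ε hε => ⟨0, by simpa using hε⟩

variable (m : ℕ) (u : Cu A)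

theorem monotone_isDivisible : Monotone fun n => IsDivisible m n u := by
  intro n n' hn h u' hu'
  obtain ⟨x, hle, hge⟩ := h u' hu'
  exact ⟨x, hle, hge.trans (nsmul_le_nsmul_left x.zero_le hn)⟩

theorem monotone_isDecomposable : Monotone fun n => IsDecomposable m n u := by
  intro n n' hn h u' hu'
  obtain ⟨x, hle, hge⟩ := h u' hu'
  exact ⟨x, hle, fun j => (hge j).trans (nsmul_le_nsmul_left (x j).zero_le hn)⟩

theorem monotone_isWeaklyDivisible : Monotone fun n => IsWeaklyDivisible m n u := by
  refine monotone_nat_of_le_succ fun n h u' hu' => ?_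
  obtain ⟨x, hle, hge⟩ := h u' hu'
  refine ⟨Fin.snoc x 0, Fin.lastCases ?_ fun j => ?_, by simpa [Fin.sum_univ_castSucc] using hge⟩
  · simpa using u.zero_le
  · simpa using hle j

end Divisibility

section LeastPos

variable {p : ℕ → Prop} {q : ℕ → ℕ → Prop}

theorem one_le_leastPos (p : ℕ → Prop) : 1 ≤ leastPos p := by
  refine le_sInf ?_
  rintro _ ⟨n, hn, _, rfl⟩
  exact_mod_cast hn

theorem leastPos_le_coe_iff (hp : Monotone p) {n : ℕ} (hn : 1 ≤ n) : leastPos p ≤ n ↔ p n := by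
  refine ⟨fun h => ?_, fun h => sInf_le ⟨n, hn, h, rfl⟩⟩
  obtain ⟨_, ⟨k, _, hk, rfl⟩, hkn⟩ :=
    sInf_lt_iff.1 ((ENat.lt_add_one_iff (ENat.natCast_ne_top n)).2 h)
  exact hp (Nat.lt_succ_iff.1 (by exact_mod_cast hkn)) hk

theorem leastPos_eq_of_forall_le_coe_iff (hp : Monotone p) {x : ℕ∞} (hx : 1 ≤ x)
    (h : ∀ n : ℕ, 1 ≤ n → (x ≤ n ↔ p n)) : leastPos p = x := by
  refine WithTop.eq_of_forall_le_coe_iff fun n => ?_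
  change leastPos p ≤ (n : ℕ∞) ↔ x ≤ (n : ℕ∞)
  rcases n.eq_zero_or_pos with rfl | hn
  · exact iff_of_false (fun hle => by simpa using (one_le_leastPos p).trans hle)
      fun hle => by simpa using hx.trans hle
  · rw [leastPos_le_coe_iff hp hn, h n hn]

theorem leastPos_eq_iSup (hp : Monotone p) (hq : ∀ k, Monotone (q k))
    (h : ∀ n, p n ↔ ∀ k, q k n) : leastPos p = ⨆ k, leastPos (q k) := by
  refine leastPos_eq_of_forall_le_coe_iff hp (le_iSup_of_le 0 (one_le_leastPos (q 0)))
    fun n hn => ?_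
  rw [iSup_le_iff, h]
  exact forall_congr' fun k => leastPos_le_coe_iff (hq k) hn

theorem leastPos_eq_limsup {ω : Filter ℕ} [ω.NeBot] (hp : Monotone p) (hq : ∀ k, Monotone (q k))
    (h : ∀ n, p n ↔ ∀ᶠ k in ω, q k n) : leastPos p = limsup (fun k => leastPos (q k)) ω := by
  refine leastPos_eq_of_forall_le_coe_iff hp
    (le_limsup_of_frequently_le (.of_forall fun k => one_le_leastPos (q k))) fun n hn => ?_
  simp only [h, ← leastPos_le_coe_iff (hq _) hn]
  refine ⟨fun hle => ?_, fun hev => limsup_le_of_le (h := hev)⟩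
  have hlt := (ENat.lt_add_one_iff (ENat.natCast_ne_top n)).2 hle
  exact (eventually_lt_of_limsup_lt hlt).mono fun k =>
    (ENat.lt_add_one_iff (ENat.natCast_ne_top n)).1

end LeastPos

section Sequences

variable (A : ℕ → Type u) [∀ k, CStarAlgebra (A k)] (ω : Filter ℕ) {m : ℕ}

theorem bigDiv_bprod (hm : 1 ≤ m) : bigDiv m (BProd A) = ⨆ k, bigDiv m (A k) := by
  refine leastPos_eq_iSup (monotone_isDivisible m _) (fun _ => monotone_isDivisible m _)
    fun n => ?_
  simp only [isDivisible_unitClass_iff]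
  exact solvable_bprod_iff A (fun _ => ⟨((), ⟨0, hm⟩), rfl⟩) _

theorem decDiv_bprod : decDiv m (BProd A) = ⨆ k, decDiv m (A k) := by
  refine leastPos_eq_iSup (monotone_isDecomposable m _) (fun _ => monotone_isDecomposable m _)
    fun n => ?_
  simp only [isDecomposable_unitClass_iff]
  exact solvable_bprod_iff A (fun j => ⟨((), j), rfl⟩) _

theorem weakDiv_bprod (hm : 1 ≤ m) : weakDiv m (BProd A) = ⨆ k, weakDiv m (A k) := by
  refine leastPos_eq_iSup (monotone_isWeaklyDivisible m _)
    (fun _ => monotone_isWeaklyDivisible m _) fun n => ?_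
  simp only [isWeaklyDivisible_unitClass_iff]
  exact solvable_bprod_iff A (fun j => ⟨(j, ⟨0, hm⟩), rfl⟩) _

variable [ω.NeBot]

theorem bigDiv_rprod (hm : 1 ≤ m) :
    bigDiv m (RProd A ω) = limsup (fun k => bigDiv m (A k)) ω := by
  refine leastPos_eq_limsup (monotone_isDivisible m _) (fun _ => monotone_isDivisible m _)
    fun n => ?_
  simp only [isDivisible_unitClass_iff]
  exact solvable_rprod_iff A ω (fun _ => ⟨((), ⟨0, hm⟩), rfl⟩) _

theorem decDiv_rprod : decDiv m (RProd A ω) = limsup (fun k => decDiv m (A k)) ω := by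
  refine leastPos_eq_limsup (monotone_isDecomposable m _) (fun _ => monotone_isDecomposable m _)
    fun n => ?_
  simp only [isDecomposable_unitClass_iff]
  exact solvable_rprod_iff A ω (fun j => ⟨((), j), rfl⟩) _

theorem weakDiv_rprod (hm : 1 ≤ m) :
    weakDiv m (RProd A ω) = limsup (fun k => weakDiv m (A k)) ω := by
  refine leastPos_eq_limsup (monotone_isWeaklyDivisible m _)
    (fun _ => monotone_isWeaklyDivisible m _) fun n => ?_
  simp only [isWeaklyDivisible_unitClass_iff]
  exact solvable_rprod_iff A ω (fun j => ⟨(j, ⟨0, hm⟩), rfl⟩) _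

end Sequences

end CuntzDiv

theorem mainTheorem7_general (A : ℕ → Type*) [∀ k, CStarAlgebra (A k)] (m : ℕ) (hm : 1 ≤ m) :
    ((CuntzDiv.bigDiv m (CuntzDiv.BProd A) = ⨆ k, CuntzDiv.bigDiv m (A k)) ∧
      (CuntzDiv.decDiv m (CuntzDiv.BProd A) = ⨆ k, CuntzDiv.decDiv m (A k)) ∧
      (CuntzDiv.weakDiv m (CuntzDiv.BProd A) = ⨆ k, CuntzDiv.weakDiv m (A k))) ∧
    ∀ ω : Filter ℕ, ω.NeBot →
      ((CuntzDiv.bigDiv m (CuntzDiv.RProd A ω) =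
          Filter.limsup (fun k => CuntzDiv.bigDiv m (A k)) ω) ∧
        (CuntzDiv.decDiv m (CuntzDiv.RProd A ω) =
          Filter.limsup (fun k => CuntzDiv.decDiv m (A k)) ω) ∧
        (CuntzDiv.weakDiv m (CuntzDiv.RProd A ω) =
          Filter.limsup (fun k => CuntzDiv.weakDiv m (A k)) ω)) := by
  refine ⟨⟨?_, ?_, ?_⟩, fun ω _ => ⟨?_, ?_, ?_⟩⟩
  · exact CuntzDiv.bigDiv_bprod A hm
  · exact CuntzDiv.decDiv_bprod A
  · exact CuntzDiv.weakDiv_bprod A hm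
  · exact CuntzDiv.bigDiv_rprod A ω hm
  · exact CuntzDiv.decDiv_rprod A ω
  · exact CuntzDiv.weakDiv_rprod A ω hm

theorem mainTheorem7 (A : ℕ → Type*) [∀ k, CStarAlgebra (A k)] (m : ℕ) (hm : 2 ≤ m) :
    ((CuntzDiv.bigDiv m (CuntzDiv.BProd A) = ⨆ k, CuntzDiv.bigDiv m (A k)) ∧
      (CuntzDiv.decDiv m (CuntzDiv.BProd A) = ⨆ k, CuntzDiv.decDiv m (A k)) ∧
      (CuntzDiv.weakDiv m (CuntzDiv.BProd A) = ⨆ k, CuntzDiv.weakDiv m (A k))) ∧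
    ∀ ω : Filter ℕ, ω.NeBot → ⋂₀ ω.sets = ∅ →
      ((CuntzDiv.bigDiv m (CuntzDiv.RProd A ω) =
          Filter.limsup (fun k => CuntzDiv.bigDiv m (A k)) ω) ∧
        (CuntzDiv.decDiv m (CuntzDiv.RProd A ω) =
          Filter.limsup (fun k => CuntzDiv.decDiv m (A k)) ω) ∧
        (CuntzDiv.weakDiv m (CuntzDiv.RProd A ω) =
          Filter.limsup (fun k => CuntzDiv.weakDiv m (A k)) ω)) := by
  obtain ⟨hprod, hrprod⟩ := mainTheorem7_general A m (one_le_two.trans hm)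
  exact ⟨hprod, fun ω hω _ => hrprod ω hω⟩
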